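/- Let $\pi:\mathbb R^6\to\mathbb R$, $(x,a,b,c,d,e)\mapsto x$, be the bundle whose smooth sections are identified with the equations $y'=a(x)y^4+b(x)y^3+c(x)y^2+d(x)y+e(x)$, and let $J^k(\pi)$ ($k\ge 0$) be the space of $k$-jets of its sections, with fibre coordinates $a,\dots,e,a',\dots,e',\dots$ and total derivative $D/Dx$. Let $G$ be the pseudogroup of local diffeomorphisms $x\mapsto f(x)$, $y\mapsto g(x)y+h(x)$ with $f,g,h$ smooth, $f'>0$ and $g\neq0$; it acts on these equations and, by prolongation, on every $J^k(\pi)$. Put $$I_0=a,\qquad I_1=8ac-3b^2,\qquad I_2=3(ab'-a'b)+ac^2-3abd+12a^2e,$$ $$I_3=8aa'(4ac-3b^2)+24a^2bb'-32a^3c'-3b^5+64a^3cd-24a^2b^2d-32a^2bc^2+20ab^3c,$$ $$J_1=\frac{I_2I_0}{I_1^2},\qquad J_2=\frac{I_3}{|I_1|^{5/2}},\qquad \nabla=\frac{I_0^2}{|I_1|^{3/2}}\frac{D}{Dx}.$$ A point of $J^k(\pi)$ is called regular if $I_0I_1\ne0$ at it. For an open set $U$ of regular points of $J^k(\pi)$,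 a differential invariant of order $\le k$ on $U$ is a smooth function $I:U\to\mathbb R$ that takes equal values at any two points of $U$ lying in the same $G$-orbit. Theorem 4. (i) $J_1$ and $J_2$ are differential invariants of order $1$ on the regular points of $J^1(\pi)$. The derivation $\nabla$ is invariant under the prolonged action of $G$ over the regular points, and it sends differential invariants of order $\le k$ on $U$ to differential invariants of order $\le k+1$ on the preimage of $U$ in $J^{k+1}(\pi)$. (ii) The algebra of differential invariants is generated by $J_1$, $J_2$ and $\nabla$: for every $k\ge 0$ and every open set $U$ of regular points of $J^k(\pi)$, a function $I:U\to\mathbb R$ is a differential invariant of order $\le k$ on $U$ if and only if on each of the two parts $U\cap\{I_1>0\}$ and $U\cap\{I_1<0\}$ it is a smooth function (defined on an open subset of $\mathbb R^{2k}$, possibly different for the two parts) of the $2k$ invariants $\nabla^iJ_1,\nabla^iJ_2$, $0\le i<k$. (iii) This algebra separates regular orbits: if all differential invariants of order $\le k$ on the set of regular points of $J^k(\pi)$ agree at two regular points of $J^k(\pi)$, these points lie in the same $G$-orbit. More precisely, two regular points of $J^k(\pi)$ lie in the same $G$-orbit if and only if $I_1$ has the same sign at both and $\nabla^iJ_1,\nabla^iJ_2$,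 $0\le i<k$, take the same values at both. -/

import Mathlib

open scoped ContDiff Topology

namespace GenAbel

noncomputable section

/-- The right-hand side `a y^4 + b y^3 + c y^2 + d y + e`, where `u = (a, b, c, d, e)`. -/
def rhs (u : Fin 5 → ℝ) (y : ℝ) : ℝ :=
  u 0 * y ^ 4 + u 1 * y ^ 3 + u 2 * y ^ 2 + u 3 * y + u 4

/-- The space `J^k(π)` of `k`-jets of sections of `π : ℝ^6 → ℝ`, `(x, a, b, c, d, e) ↦ x`:
a jet consists of `x` and the values `z.2 i α` of the `i`-th derivatives, `i ≤ k`, of the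
coefficients (`α = 0, 1, 2, 3, 4` for `a, b, c, d, e`). -/
abbrev Jet (k : ℕ) : Type := ℝ × (Fin (k + 1) → Fin 5 → ℝ)

/-- The `k`-jet at `x` of the section `s`. -/
def jet (k : ℕ) (s : ℝ → Fin 5 → ℝ) (x : ℝ) : Jet k :=
  (x, fun i => iteratedDeriv (i : ℕ) s x)

/-- The projection `π_{k,l} : J^k(π) → J^l(π)`, `l ≤ k`. -/
def proj {k l : ℕ} (h : l ≤ k) (z : Jet k) : Jet l :=
  (z.1, fun i => z.2 (Fin.castLE (Nat.succ_le_succ h) i))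

/-- An element of the pseudogroup `G`: a local diffeomorphism
`(x, y) ↦ (f x, g x * y + h x)`, defined over an open set of `x`'s, with `f` preserving the
orientation of the `x`-axis. -/
structure Trans where
  dom : Set ℝ
  f : ℝ → ℝ
  g : ℝ → ℝ
  h : ℝ → ℝ
  isOpen_dom : IsOpen dom
  smooth_f : ContDiffOn ℝ ∞ f dom
  smooth_g : ContDiffOn ℝ ∞ g dom
  smooth_h : ContDiffOn ℝ ∞ h dom
  injOn_f : Set.InjOn f dom
  deriv_f_pos : ∀ x ∈ dom, 0 < deriv f x
  g_ne_zero : ∀ x ∈ dom, g x ≠ 0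

/-- The transformation `φ` sends the equation `y' = rhs (s x) y` over `φ.dom` to the equation
`Y' = rhs (t X) Y` over `φ.f '' φ.dom`: if `X = f x`, `Y = g x * y + h x` and
`dy/dx = rhs (s x) y`, then `dY/dX = (g * dy/dx + g' * y + h') / f'` equals `rhs (t X) Y`. -/
def Trans.Maps (φ : Trans) (s t : ℝ → Fin 5 → ℝ) : Prop :=
  ∀ x ∈ φ.dom, ∀ y : ℝ,
    rhs (t (φ.f x)) (φ.g x * y + φ.h x) =
      (φ.g x * rhs (s x) y + deriv φ.g x * y + deriv φ.h x) / deriv φ.f x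

/-- The `k`-th prolongation `φ^(k)` of `φ` to `J^k(π)`, given by its graph: `φ^(k)` is defined
over `φ.dom` and sends the `k`-jet of a section `s` at `x` to the `k`-jet at `φ.f x` of the
section `t` to which `φ` sends `s`. -/
def Trans.Prolong (φ : Trans) (k : ℕ) (z w : Jet k) : Prop :=
  z.1 ∈ φ.dom ∧ ∃ s t : ℝ → Fin 5 → ℝ,
    ContDiffOn ℝ ∞ s φ.dom ∧ ContDiffOn ℝ ∞ t (φ.f '' φ.dom) ∧ φ.Maps s t ∧
      jet k s z.1 = z ∧ jet k t (φ.f z.1) = w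

/-- `z` and `w` lie in the same orbit of the prolonged action of `G` on `J^k(π)`. -/
def SameOrbit (k : ℕ) (z w : Jet k) : Prop := ∃ φ : Trans, φ.Prolong k z w

/-- The relative invariant `a`. -/
def I0 {k : ℕ} (z : Jet k) : ℝ := z.2 0 0

/-- The relative invariant `8 a c - 3 b^2`. -/
def I1 {k : ℕ} (z : Jet k) : ℝ := 8 * z.2 0 0 * z.2 0 2 - 3 * z.2 0 1 ^ 2

/-- The relative invariant `3 (a b' - a' b) + a c^2 - 3 a b d + 12 a^2 e`. -/
def I2 (z : Jet 1) : ℝ :=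
  let a := z.2 0 0
  let b := z.2 0 1
  let c := z.2 0 2
  let d := z.2 0 3
  let e := z.2 0 4
  let a' := z.2 1 0
  let b' := z.2 1 1
  3 * (a * b' - a' * b) + a * c ^ 2 - 3 * a * b * d + 12 * a ^ 2 * e

/-- The second relative invariant of order one. -/
def I3 (z : Jet 1) : ℝ :=
  let a := z.2 0 0
  let b := z.2 0 1
  let c := z.2 0 2
  let d := z.2 0 3
  let a' := z.2 1 0
  let b' := z.2 1 1
  let c' := z.2 1 2
  8 * a * a' * (4 * a * c - 3 * b ^ 2) + 24 * a ^ 2 * b * b' - 32 * a ^ 3 * c' - 3 * b ^ 5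
    + 64 * a ^ 3 * c * d - 24 * a ^ 2 * b ^ 2 * d - 32 * a ^ 2 * b * c ^ 2 + 20 * a * b ^ 3 * c

/-- The set of regular points of `J^k(π)`. -/
def regular (k : ℕ) : Set (Jet k) := {z | I0 z * I1 z ≠ 0}

/-- `J_1 = I_2 I_0 / I_1^2`. -/
def J1 (z : Jet 1) : ℝ := I2 z * I0 z / I1 z ^ 2

/-- `J_2 = I_3 / |I_1|^(5/2)`. -/
def J2 (z : Jet 1) : ℝ := I3 z / |I1 z| ^ (5 / 2 : ℝ)

/-- The total derivative `D/Dx`, from functions on `J^k(π)` to functions on `J^(k+1)(π)`: the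
derivative of `F` in the direction `∂/∂x + a' ∂/∂a + b' ∂/∂b + ... + a'' ∂/∂a' + ...`. -/
def totalDeriv {k : ℕ} (F : Jet k → ℝ) (z : Jet (k + 1)) : ℝ :=
  fderiv ℝ F (proj (Nat.le_succ k) z) (1, fun i => z.2 i.succ)

/-- The derivation `∇ = I_0^2 / |I_1|^(3/2) D/Dx`. -/
def nabla {k : ℕ} (F : Jet k → ℝ) (z : Jet (k + 1)) : ℝ :=
  I0 z ^ 2 / |I1 z| ^ (3 / 2 : ℝ) * totalDeriv F z

/-- `∇^i F`, a function on `J^(i+1)(π)`, for a function `F` on `J^1(π)`. -/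
def nablaIter (F : Jet 1 → ℝ) : (i : ℕ) → Jet (i + 1) → ℝ
  | 0 => F
  | i + 1 => nabla (nablaIter F i)

/-- The values at a `k`-jet of all `∇^i J_1` and `∇^i J_2` of order at most `k`
(that is, `0 ≤ i < k`). -/
def basic (k : ℕ) (z : Jet k) : Fin 2 → Fin k → ℝ :=
  fun j i => nablaIter (if j = 0 then J1 else J2) i (proj (Nat.succ_le_of_lt i.isLt) z)

/-- `I` is a (smooth) differential invariant of order at most `k` on `U ⊆ J^k(π)`: it is constant
along the orbits of the prolonged action of `G`. -/
def IsDiffInvariant (k : ℕ) (U : Set (Jet k)) (I : Jet k → ℝ) : Prop :=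
  ContDiffOn ℝ ∞ I U ∧ ∀ z ∈ U, ∀ w ∈ U, SameOrbit k z w → I z = I w

/-- On the set `W`, the function `I` is a smooth function of the `∇^i J_1`, `∇^i J_2`, `i < k`. -/
def IsGeneratedOn (k : ℕ) (W : Set (Jet k)) (I : Jet k → ℝ) : Prop :=
  ∃ (V : Set (Fin 2 → Fin k → ℝ)) (F : (Fin 2 → Fin k → ℝ) → ℝ),
    IsOpen V ∧ ContDiffOn ℝ ∞ F V ∧ ∀ z ∈ W, basic k z ∈ V ∧ I z = F (basic k z)

/-- `∇` is invariant under `G`, i.e. `∇ (φ^* F) = φ^* (∇ F)` over regular points: if `F'` equals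
`φ^* F = F ∘ φ^(k)` near the `k`-jet under `z`, then `∇ F'` at `z` is `∇ F` at `φ^(k+1) z`. -/
def NablaInvariant : Prop :=
  ∀ (φ : Trans) (k : ℕ) (F F' : Jet k → ℝ) (z w : Jet (k + 1)),
    z ∈ regular (k + 1) → φ.Prolong (k + 1) z w →
    ContDiffAt ℝ ∞ F (proj (Nat.le_succ k) w) → ContDiffAt ℝ ∞ F' (proj (Nat.le_succ k) z) →
    (∀ᶠ z' in 𝓝 (proj (Nat.le_succ k) z), ∀ w', φ.Prolong k z' w' → F' z' = F w') →
    nabla F' z = nabla F w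

end

end GenAbel

/-! Under a transformation the coefficients pull back with weights: `a` scales by `f' g^3`, `I1` by
`f'^2 g^4`, `I2` by `f'^3 g^5`, `I3` by `f'^5 g^10` (`Trans.Maps.coeff`,
`Trans.Maps.relative_invariants`). Hence `J1`, `J2` are invariant, and `a^2 / |I1|^(3/2)` scales
like the coefficient of a vector field on the line, which makes `∇` invariant
(`Trans.Maps.weight_eq`). Along a section, `∇` is the ordinary operator `ρ d/dx` with `ρ = weight
s`, so all questions about jets become questions about functions of one variable and their order of
vanishing.

Separation is a normalisation argument (`sameOrbit_of_basic_eq`). Given sections `s`, `t` through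
two regular jets with the same sign of `I1`, the equation `f' = ρ_t(f) / ρ_s` fixes `f`; then `g`
and `h` can be chosen algebraically so that `a`, `b`, `c` match identically near the point
(`push_leading`). With `a`, `b`, `c` fixed, `J1`, `J2` are affine in the undifferentiated `d`, `e`,
with an invertible triangular linear part, so equality of `∇^i J1`, `∇^i J2` for `i < k` makes `d`,
`e` agree through order `k - 1` (`SameLeading.isBigO_sub`). The derivatives of `d`, `e` of order `k`
are not seen by the invariants; they are corrected by replacing `g`, `h` by `g e^γ`, `h + η` with
`γ`, `η` vanishing to order `k + 1`, which leaves the `k`-jets of `a`, `b`, `c` unchanged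
(`agreeTo_push`).

Generation follows from separation together with smooth right inverses of `basic`: fixing every
other jet coordinate, `basic` is an affine bijection in the `2k` derivatives of `d`, `e` of order `<
k` (`exists_local_section_basic`). An invariant is constant on the fibres of `basic` where `I1` has
constant sign, so it descends, and composing with a right inverse shows that the descended function
is smooth. -/

namespace GenAbel

open Set Filter Asymptotics


/-! ### Order of vanishing and the operator `ρ d/dx` in one variable. -/

section Analysis

variable {E : Type*} [NormedAddCommGroup E] [NormedSpace ℝ E]

/-- If `u` vanishes at `x₀` and its derivative vanishes to order `n`, then `u` vanishes to
order `n + 1`. -/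
theorem isBigO_pow_succ_of_hasDerivAt {u u' : ℝ → E} {x₀ : ℝ} {n : ℕ}
    (hu : ∀ᶠ x in 𝓝 x₀, HasDerivAt u (u' x) x) (h₀ : u x₀ = 0)
    (hO : u' =O[𝓝 x₀] fun x => (x - x₀) ^ n) :
    u =O[𝓝 x₀] fun x => (x - x₀) ^ (n + 1) := by
  obtain ⟨C, hC⟩ := hO.bound
  obtain ⟨ε, hε, hball⟩ := Metric.eventually_nhds_iff_ball.1 (hu.and hC)
  refine IsBigO.of_bound C ?_
  filter_upwards [Metric.ball_mem_nhds x₀ hε] with x hx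
  have hsub : Metric.closedBall x₀ |x - x₀| ⊆ Metric.ball x₀ ε := by
    apply Metric.closedBall_subset_ball
    simpa [Real.dist_eq] using hx
  have hC0 : ∀ y ∈ Metric.closedBall x₀ |x - x₀|, ‖u' y‖ ≤ C * |x - x₀| ^ n := by
    intro y hy
    have h1 := (hball y (hsub hy)).2
    have hy' : |y - x₀| ≤ |x - x₀| := by simpa [Real.dist_eq] using hy
    -- The constant of the `O`-bound has no prescribed sign, and monotonicity in `|y - x₀|` needs `0
    -- ≤ C`. A negative `C` leaves only the cases `n = 0` and `x = x₀`.
    rcases le_or_gt 0 C with h | h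
    · refine h1.trans ?_
      rw [norm_pow, Real.norm_eq_abs]
      gcongr
    · have h2 := (hball x₀ (Metric.mem_ball_self hε)).2
      have h3 := (hball y (hsub hy)).2
      rcases Nat.eq_zero_or_pos n with rfl | hn
      · simpa using h3
      · have h4 := (hball x hx).2
        rw [norm_pow, Real.norm_eq_abs] at h3 h4
        have h5 : |x - x₀| ^ n = 0 := by
          by_contra hne
          have : 0 < |x - x₀| ^ n := lt_of_le_of_ne (by positivity) (Ne.symm hne)
          nlinarith [norm_nonneg (u' x)]
        have h6 : |x - x₀| = 0 := by
          exact pow_eq_zero_iff (by omega) |>.1 h5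
        have h7 : y = x₀ := by
          rw [h6] at hy'
          have := abs_eq_zero.1 (le_antisymm hy' (abs_nonneg _))
          linarith
        rw [h5]
        rw [h7] at h3 ⊢
        simpa [zero_pow (show n ≠ 0 by omega)] using h3
  have := (convex_closedBall x₀ |x - x₀|).norm_image_sub_le_of_norm_hasDerivWithin_le
    (fun y hy => (hball y (hsub hy)).1.hasDerivWithinAt) hC0
    (Metric.mem_closedBall_self (abs_nonneg _)) (show x ∈ _ by simp [Real.dist_eq])
  rw [h₀, sub_zero] at this
  refine this.trans (le_of_eq ?_)
  rw [norm_pow, Real.norm_eq_abs, pow_succ, mul_assoc]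

/-- The derivation `ρ d/dx` on functions of one variable. -/
noncomputable def dop (ρ : ℝ → ℝ) (u : ℝ → E) : ℝ → E := fun x => ρ x • deriv u x

theorem contDiffOn_dop {ρ : ℝ → ℝ} {u : ℝ → E} {O : Set ℝ} (hO : IsOpen O)
    (hρ : ContDiffOn ℝ ∞ ρ O) (hu : ContDiffOn ℝ ∞ u O) : ContDiffOn ℝ ∞ (dop ρ u) O :=
  hρ.smul ((contDiffOn_infty_iff_deriv_of_isOpen hO).1 hu).2

theorem contDiffOn_dop_iterate {ρ : ℝ → ℝ} {u : ℝ → E} {O : Set ℝ} (hO : IsOpen O)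
    (hρ : ContDiffOn ℝ ∞ ρ O) (hu : ContDiffOn ℝ ∞ u O) (i : ℕ) :
    ContDiffOn ℝ ∞ ((dop ρ)^[i] u) O := by
  induction i with
  | zero => exact hu
  | succ i ih =>
    rw [Function.iterate_succ_apply']
    exact contDiffOn_dop hO hρ ih

theorem dop_congr {ρ σ : ℝ → ℝ} {u v : ℝ → E} {O : Set ℝ} (hO : IsOpen O)
    (hρ : EqOn ρ σ O) (h : EqOn u v O) : EqOn (dop ρ u) (dop σ v) O := fun x hx => by
  have : u =ᶠ[𝓝 x] v := h.eventuallyEq_of_mem (hO.mem_nhds hx)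
  simp only [dop, hρ hx, this.deriv_eq]

theorem dop_iterate_congr {ρ σ : ℝ → ℝ} {u v : ℝ → E} {O : Set ℝ} (hO : IsOpen O)
    (hρ : EqOn ρ σ O) (h : EqOn u v O) (i : ℕ) : EqOn ((dop ρ)^[i] u) ((dop σ)^[i] v) O := by
  induction i with
  | zero => exact h
  | succ i ih =>
    simp only [Function.iterate_succ_apply']
    exact dop_congr hO hρ ih

theorem _root_.ContDiffOn.hasDerivAt_deriv {u : ℝ → E} {O : Set ℝ} (hu : ContDiffOn ℝ ∞ u O)
    (hO : IsOpen O) {x : ℝ} (hx : x ∈ O) : HasDerivAt u (deriv u x) x :=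
  ((hu.contDiffAt (hO.mem_nhds hx)).differentiableAt (by simp)).hasDerivAt

theorem dop_iterate_add {ρ : ℝ → ℝ} {u v : ℝ → E} {O : Set ℝ} (hO : IsOpen O)
    (hρ : ContDiffOn ℝ ∞ ρ O) (hu : ContDiffOn ℝ ∞ u O) (hv : ContDiffOn ℝ ∞ v O) (i : ℕ) :
    EqOn ((dop ρ)^[i] (u + v)) ((dop ρ)^[i] u + (dop ρ)^[i] v) O := by
  induction i with
  | zero => intro x _; rfl
  | succ i ih =>
    intro x hx
    simp only [Function.iterate_succ_apply', Pi.add_apply]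
    rw [dop_congr hO (fun _ _ => rfl) ih hx]
    have h1 := (contDiffOn_dop_iterate hO hρ hu i).hasDerivAt_deriv hO hx
    have h2 := (contDiffOn_dop_iterate hO hρ hv i).hasDerivAt_deriv hO hx
    simp only [dop, (h1.add h2).deriv, smul_add]

theorem dop_iterate_const_smul {ρ : ℝ → ℝ} {u : ℝ → E} {O : Set ℝ} (hO : IsOpen O)
    (hρ : ContDiffOn ℝ ∞ ρ O) (hu : ContDiffOn ℝ ∞ u O) (c : ℝ) (i : ℕ) :
    EqOn ((dop ρ)^[i] (c • u)) (c • (dop ρ)^[i] u) O := by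
  induction i with
  | zero => intro x _; rfl
  | succ i ih =>
    intro x hx
    simp only [Function.iterate_succ_apply', Pi.smul_apply]
    rw [dop_congr hO (fun _ _ => rfl) ih hx]
    have h1 := (contDiffOn_dop_iterate hO hρ hu i).hasDerivAt_deriv hO hx
    simp only [dop, (h1.const_smul c).deriv, smul_comm c]

/-- By induction `ρ u'` vanishes to order `k`; since `ρ⁻¹` is bounded near `x₀`, so does `u'`, and
integration gains one order. -/
theorem isBigO_pow_of_dop_iterate {ρ : ℝ → ℝ} {O : Set ℝ} {x₀ : ℝ} (hO : IsOpen O)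
    (hx₀ : x₀ ∈ O) (hρ : ContDiffOn ℝ ∞ ρ O) (hne : ρ x₀ ≠ 0) (k : ℕ) :
    ∀ {u : ℝ → E}, ContDiffOn ℝ ∞ u O → (∀ i < k, (dop ρ)^[i] u x₀ = 0) →
      u =O[𝓝 x₀] fun x => (x - x₀) ^ k := by
  induction k with
  | zero =>
    intro u hu _
    simpa using (hu.continuousOn.continuousAt (hO.mem_nhds hx₀)).isBigO_one ℝ
  | succ k ih =>
    intro u hu h
    have h1 := ih (contDiffOn_dop hO hρ hu) fun i hi => h (i + 1) (by omega)
    have hρc := hρ.continuousOn.continuousAt (hO.mem_nhds hx₀)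
    refine isBigO_pow_succ_of_hasDerivAt (u' := deriv u) ?_ (h 0 (by omega)) ?_
    · filter_upwards [hO.mem_nhds hx₀] with x hx using hu.hasDerivAt_deriv hO hx
    · have h2 := ((hρc.inv₀ hne).isBigO_one ℝ).smul h1
      refine (h2.congr' ?_ ?_)
      · filter_upwards [hρc.eventually_ne hne] with x hx
        simp [dop, smul_smul, inv_mul_cancel₀ hx]
      · simp

theorem dop_one_iterate (u : ℝ → E) (i : ℕ) : (dop (fun _ => 1))^[i] u = iteratedDeriv i u := by
  rw [iteratedDeriv_eq_iterate]
  congr 1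
  funext v x
  simp [dop]

theorem isBigO_pow_of_iteratedDeriv {O : Set ℝ} {x₀ : ℝ} (hO : IsOpen O) (hx₀ : x₀ ∈ O) {k : ℕ}
    {u : ℝ → E} (hu : ContDiffOn ℝ ∞ u O) (h : ∀ i < k, iteratedDeriv i u x₀ = 0) :
    u =O[𝓝 x₀] fun x => (x - x₀) ^ k :=
  isBigO_pow_of_dop_iterate (ρ := fun _ => 1) hO hx₀ contDiffOn_const one_ne_zero k hu
    fun i hi => by rw [dop_one_iterate]; exact h i hi

theorem iteratedDeriv_sub_pow_smul (x₀ : ℝ) (i j : ℕ) (v : E) :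
    iteratedDeriv i (fun x : ℝ => ((x - x₀) ^ j / (j.factorial : ℝ)) • v) x₀ =
      if i = j then v else 0 := by
  have h1 : iteratedDeriv i (fun x : ℝ => ((x - x₀) ^ j / (j.factorial : ℝ)) • v) x₀ =
      iteratedDeriv i (fun x : ℝ => ((x - x₀) ^ j / (j.factorial : ℝ))) x₀ • v := by
    have : ContDiff ℝ i (fun x : ℝ => ((x - x₀) ^ j / (j.factorial : ℝ))) := by fun_prop
    exact iteratedDeriv_smul_const this.contDiffAt v
  have h2 : iteratedDeriv i (fun x : ℝ => ((x - x₀) ^ j / (j.factorial : ℝ))) x₀ =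
      iteratedDeriv i (fun x : ℝ => (x ^ j / (j.factorial : ℝ))) 0 := by
    have := congrFun (iteratedDeriv_comp_sub_const (𝕜 := ℝ) i
      (fun x : ℝ => (x ^ j / (j.factorial : ℝ))) x₀) x₀
    simpa using this
  rw [h1, h2, iteratedDeriv_div_const, iteratedDeriv_fun_pow_zero]
  split_ifs with h
  · subst h
    rw [div_self (by positivity), one_smul]
  · simp

/-- Remove the first possibly nonzero Taylor term, of degree `i`: the rest is `O((x - x₀)^(i+1))`,
so a nonzero coefficient would force `(x - x₀)^i = O((x - x₀)^(i+1))`. -/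
theorem iteratedDeriv_eq_zero_of_isBigO_pow {O : Set ℝ} {x₀ : ℝ} (hO : IsOpen O) (hx₀ : x₀ ∈ O)
    {k : ℕ} {u : ℝ → E} (hu : ContDiffOn ℝ ∞ u O) (h : u =O[𝓝 x₀] fun x => (x - x₀) ^ k) :
    ∀ i < k, iteratedDeriv i u x₀ = 0 := by
  intro i
  induction i using Nat.strong_induction_on with
  | _ i ih =>
    intro hi
    set c := iteratedDeriv i u x₀ with hc
    have hm : ContDiff ℝ ∞ (fun x : ℝ => ((x - x₀) ^ i / (i.factorial : ℝ)) • c) := by fun_prop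
    have h1 : (u - fun x : ℝ => ((x - x₀) ^ i / (i.factorial : ℝ)) • c)
        =O[𝓝 x₀] fun x => (x - x₀) ^ (i + 1) := by
      refine isBigO_pow_of_iteratedDeriv hO hx₀ (hu.sub hm.contDiffOn) fun j hj => ?_
      rw [iteratedDeriv_sub ((hu.contDiffAt (hO.mem_nhds hx₀)).of_le (by exact_mod_cast le_top))
        (hm.contDiffAt.of_le (by exact_mod_cast le_top)), iteratedDeriv_sub_pow_smul]
      split_ifs with hji
      · subst hji; simp [hc]
      · rw [ih j (by omega) (by omega), sub_zero]
    have h2 : u =O[𝓝 x₀] fun x => (x - x₀) ^ (i + 1) := h.trans (IsBigO.of_bound 1 (by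
      filter_upwards [Metric.ball_mem_nhds x₀ one_pos] with x hx
      rw [one_mul, norm_pow, norm_pow]
      refine pow_le_pow_of_le_one (norm_nonneg _) ?_ hi
      rw [Metric.mem_ball, dist_eq_norm] at hx
      exact hx.le))
    have h3 : (fun x : ℝ => ((x - x₀) ^ i / (i.factorial : ℝ)) • c)
        =O[𝓝 x₀] fun x => (x - x₀) ^ (i + 1) := by
      simpa using h2.sub h1
    by_contra hne
    have h4 : (fun x : ℝ => (x - x₀) ^ i) =O[𝓝 x₀] fun x => (x - x₀) ^ (i + 1) := by
      refine IsBigO.trans (IsBigO.of_bound (i.factorial / ‖c‖) (Eventually.of_forall fun x => ?_)) h3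
      have : 0 < ‖c‖ := norm_pos_iff.2 hne
      have hf : (0 : ℝ) < i.factorial := by positivity
      rw [norm_smul, norm_div, Real.norm_of_nonneg hf.le]
      field_simp
      rfl
    obtain ⟨C, hC⟩ := h4.bound
    obtain ⟨ε, hε, hb⟩ := Metric.eventually_nhds_iff_ball.1 hC
    have hC' : 0 < |C| + 1 := by positivity
    -- The first bound keeps `x₀ + δ` in the ball, the second gives `δ (|C| + 1) ≤ 1/2`, so the
    -- estimate at `x₀ + δ` reads `δ^i ≤ δ^i / 2`.
    set δ := min (ε / 2) (1 / (2 * (|C| + 1))) with hδ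
    have hδ0 : 0 < δ := by positivity
    have h5 := hb (x₀ + δ) (by
      rw [Metric.mem_ball, Real.dist_eq, add_sub_cancel_left, abs_of_pos hδ0]
      exact (min_le_left _ _).trans_lt (by linarith))
    rw [add_sub_cancel_left, norm_pow, norm_pow, Real.norm_of_nonneg hδ0.le, pow_succ] at h5
    have h6 : 0 < δ ^ i := by positivity
    have h7 : δ * (|C| + 1) ≤ 1 / 2 := by
      have : δ ≤ 1 / (2 * (|C| + 1)) := min_le_right _ _
      calc δ * (|C| + 1) ≤ 1 / (2 * (|C| + 1)) * (|C| + 1) := by gcongr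
        _ = 1 / 2 := by field_simp
    have h8 : C * (δ ^ i * δ) ≤ (|C| + 1) * (δ ^ i * δ) := by
      gcongr
      linarith [le_abs_self C]
    nlinarith

end Analysis


/-! ### Smoothness on jet space, and restriction to jets of sections. -/

section Jets

theorem jet_snd_zero (k : ℕ) (s : ℝ → Fin 5 → ℝ) (x : ℝ) : (jet k s x).2 0 = s x := by
  simp [jet]

theorem contDiff_proj {k l : ℕ} (h : l ≤ k) : ContDiff ℝ ∞ (proj h) := by
  unfold proj
  fun_prop

theorem contDiff_I0 {k : ℕ} : ContDiff ℝ ∞ (I0 : Jet k → ℝ) := by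
  unfold I0
  fun_prop

theorem contDiff_I1 {k : ℕ} : ContDiff ℝ ∞ (I1 : Jet k → ℝ) := by
  unfold I1
  fun_prop

theorem isOpen_regular (k : ℕ) : IsOpen (regular k) :=
  (contDiff_I0.continuous.mul contDiff_I1.continuous).isOpen_preimage _ isOpen_ne

theorem I1_ne_zero {k : ℕ} {z : Jet k} (hz : z ∈ regular k) : I1 z ≠ 0 := right_ne_zero_of_mul hz

theorem contDiffAt_abs_rpow {p x : ℝ} (hx : x ≠ 0) :
    ContDiffAt ℝ ∞ (fun y : ℝ => |y| ^ p) x :=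
  (contDiffAt_abs hx).rpow_const_of_ne (abs_ne_zero.2 hx)

theorem contDiffOn_J1 : ContDiffOn ℝ ∞ J1 (regular 1) := by
  unfold J1
  refine ContDiffOn.div ?_ (contDiff_I1.pow 2).contDiffOn fun z hz => pow_ne_zero 2 (I1_ne_zero hz)
  refine (ContDiff.mul ?_ contDiff_I0).contDiffOn
  unfold I2
  fun_prop

theorem contDiffOn_J2 : ContDiffOn ℝ ∞ J2 (regular 1) := by
  unfold J2
  refine ContDiffOn.div (ContDiff.contDiffOn ?_) (fun z hz => ?_) fun z hz => ?_
  · unfold I3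
    fun_prop
  · exact ((contDiffAt_abs_rpow (I1_ne_zero hz)).comp z contDiff_I1.contDiffAt).contDiffWithinAt
  · exact (Real.rpow_pos_of_pos (abs_pos.2 (I1_ne_zero hz)) _).ne'

theorem contDiffOn_totalDeriv {k : ℕ} {U : Set (Jet k)} (hU : IsOpen U) {F : Jet k → ℝ}
    (hF : ContDiffOn ℝ ∞ F U) :
    ContDiffOn ℝ ∞ (totalDeriv F) (proj (Nat.le_succ k) ⁻¹' U) := by
  unfold totalDeriv
  refine ContDiffOn.clm_apply ?_ (ContDiff.contDiffOn (by fun_prop))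
  exact (hF.fderiv_of_isOpen hU (m := ∞) le_rfl).comp (contDiff_proj _).contDiffOn
    (mapsTo_preimage _ _)

theorem contDiffOn_nabla {k : ℕ} {U : Set (Jet k)} (hU : IsOpen U) (hUr : U ⊆ regular k)
    {F : Jet k → ℝ} (hF : ContDiffOn ℝ ∞ F U) :
    ContDiffOn ℝ ∞ (nabla F) (proj (Nat.le_succ k) ⁻¹' U) := by
  unfold nabla
  refine ContDiffOn.mul ?_ (contDiffOn_totalDeriv hU hF)
  refine ContDiffOn.div (contDiff_I0.pow 2).contDiffOn (fun z hz => ?_) fun z hz => ?_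
  · exact ((contDiffAt_abs_rpow (I1_ne_zero (z := z) (hUr hz))).comp z
      contDiff_I1.contDiffAt).contDiffWithinAt
  · exact (Real.rpow_pos_of_pos (abs_pos.2 (I1_ne_zero (z := z) (hUr hz))) _).ne'

theorem contDiffOn_nablaIter {F : Jet 1 → ℝ} (hF : ContDiffOn ℝ ∞ F (regular 1)) (i : ℕ) :
    ContDiffOn ℝ ∞ (nablaIter F i) (regular (i + 1)) := by
  induction i with
  | zero => exact hF
  | succ i ih => exact contDiffOn_nabla (isOpen_regular _) le_rfl ih

theorem contDiffOn_basic (k : ℕ) : ContDiffOn ℝ ∞ (basic k) (regular k) := by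
  refine contDiffOn_pi.2 fun j => contDiffOn_pi.2 fun i => ?_
  have h : ContDiffOn ℝ ∞ (nablaIter (if j = 0 then J1 else J2) i) (regular (i + 1)) := by
    apply contDiffOn_nablaIter
    split_ifs
    exacts [contDiffOn_J1, contDiffOn_J2]
  exact h.comp (contDiff_proj _).contDiffOn fun z hz => hz

variable {s t : ℝ → Fin 5 → ℝ} {O : Set ℝ} {x : ℝ}

theorem contDiffOn_iteratedDeriv {E : Type*} [NormedAddCommGroup E] [NormedSpace ℝ E] {u : ℝ → E}
    (hO : IsOpen O) (hu : ContDiffOn ℝ ∞ u O) (i : ℕ) :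
    ContDiffOn ℝ ∞ (iteratedDeriv i u) O := by
  rw [← dop_one_iterate]
  exact contDiffOn_dop_iterate hO contDiffOn_const hu i

theorem contDiffOn_jet (hO : IsOpen O) (hs : ContDiffOn ℝ ∞ s O) (k : ℕ) :
    ContDiffOn ℝ ∞ (jet k s) O :=
  contDiffOn_id.prodMk (contDiffOn_pi.2 fun i => contDiffOn_iteratedDeriv hO hs i)

theorem hasDerivAt_jet (hO : IsOpen O) (hs : ContDiffOn ℝ ∞ s O) (hx : x ∈ O) (k : ℕ) :
    HasDerivAt (jet k s) (1, fun i => (jet (k + 1) s x).2 i.succ) x := by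
  refine (hasDerivAt_id x).prodMk (hasDerivAt_pi.2 fun i => ?_)
  have := (contDiffOn_iteratedDeriv hO hs i).hasDerivAt_deriv hO hx
  rw [← iteratedDeriv_succ] at this
  exact this

theorem hasDerivAt_comp_jet (hO : IsOpen O) (hs : ContDiffOn ℝ ∞ s O) (hx : x ∈ O) {k : ℕ}
    {F : Jet k → ℝ} (hF : DifferentiableAt ℝ F (jet k s x)) :
    HasDerivAt (fun y => F (jet k s y)) (totalDeriv F (jet (k + 1) s x)) x :=
  hF.hasFDerivAt.comp_hasDerivAt x (hasDerivAt_jet hO hs hx k)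

/-- The coefficient of `∇` along a section. -/
noncomputable def weight (s : ℝ → Fin 5 → ℝ) (x : ℝ) : ℝ :=
  s x 0 ^ 2 / |8 * s x 0 * s x 2 - 3 * s x 1 ^ 2| ^ (3 / 2 : ℝ)

/-- The section `s` is regular at `x`. -/
def RegularAt (s : ℝ → Fin 5 → ℝ) (x : ℝ) : Prop :=
  s x 0 * (8 * s x 0 * s x 2 - 3 * s x 1 ^ 2) ≠ 0

theorem I0_jet (k : ℕ) : I0 (jet k s x) = s x 0 := by simp [I0, jet_snd_zero]

theorem I1_jet (k : ℕ) : I1 (jet k s x) = 8 * s x 0 * s x 2 - 3 * s x 1 ^ 2 := by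
  simp [I1, jet_snd_zero]

theorem jet_mem_regular (k : ℕ) : jet k s x ∈ regular k ↔ RegularAt s x := by
  simp only [regular, mem_ofPred_eq, I0_jet, I1_jet, RegularAt]

theorem weight_jet (k : ℕ) :
    I0 (jet k s x) ^ 2 / |I1 (jet k s x)| ^ (3 / 2 : ℝ) = weight s x := by
  rw [I0_jet, I1_jet, weight]

theorem RegularAt.weight_pos (h : RegularAt s x) : 0 < weight s x := by
  have h1 := left_ne_zero_of_mul h
  have h2 := abs_pos.2 (right_ne_zero_of_mul h)
  unfold weight
  positivity

theorem contDiffOn_weight (hs : ContDiffOn ℝ ∞ s O) (hr : ∀ x ∈ O, RegularAt s x) :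
    ContDiffOn ℝ ∞ (weight s) O := by
  have hc := contDiffOn_pi.1 hs
  unfold weight
  refine ContDiffOn.div ((hc 0).pow 2) (fun x hx => ?_) fun x hx => ?_
  · have h1 : ContDiffWithinAt ℝ ∞ (fun x => 8 * s x 0 * s x 2 - 3 * s x 1 ^ 2) O x :=
      ((contDiffWithinAt_const.mul (hc 0 x hx)).mul (hc 2 x hx)).sub
        (contDiffWithinAt_const.mul ((hc 1 x hx).pow 2))
    exact (contDiffAt_abs_rpow (right_ne_zero_of_mul (hr x hx))).comp_contDiffWithinAt x h1
  · exact (Real.rpow_pos_of_pos (abs_pos.2 (right_ne_zero_of_mul (hr x hx))) _).ne'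

/-- The bridge from jet space to one variable: by the chain rule the total derivative becomes `d/dx`
along a section, and the coefficient of `∇` becomes `weight s`. -/
theorem nablaIter_jet (hO : IsOpen O) (hs : ContDiffOn ℝ ∞ s O) (hr : ∀ x ∈ O, RegularAt s x)
    {F : Jet 1 → ℝ} (hF : ContDiffOn ℝ ∞ F (regular 1)) (i : ℕ) :
    EqOn (fun x => nablaIter F i (jet (i + 1) s x))
      ((dop (weight s))^[i] fun x => F (jet 1 s x)) O := by
  induction i with
  | zero => intro x _; rfl
  | succ i ih =>
    intro x hx
    rw [Function.iterate_succ_apply', ← dop_congr hO (fun _ _ => rfl) ih hx]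
    have hd := ((contDiffOn_nablaIter hF i).contDiffAt ((isOpen_regular _).mem_nhds
      ((jet_mem_regular (i + 1)).2 (hr x hx)))).differentiableAt (by simp)
    simp only [nablaIter, nabla, weight_jet, dop, smul_eq_mul,
      (hasDerivAt_comp_jet hO hs hx hd).deriv]

theorem basic_jet (hO : IsOpen O) (hs : ContDiffOn ℝ ∞ s O) (hr : ∀ x ∈ O, RegularAt s x)
    (hx : x ∈ O) {k : ℕ} (j : Fin 2) (i : Fin k) :
    basic k (jet k s x) j i =
      (dop (weight s))^[i] (fun x => (if j = 0 then J1 else J2) (jet 1 s x)) x := by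
  have h : ContDiffOn ℝ ∞ (if j = 0 then J1 else J2) (regular 1) := by
    split_ifs
    exacts [contDiffOn_J1, contDiffOn_J2]
  exact nablaIter_jet hO hs hr h i hx

end Jets

/-! ### Weights of the relative invariants and invariance of `J1`, `J2`, `∇`. -/

section Invariance

variable {φ : Trans} {s t : ℝ → Fin 5 → ℝ} {x : ℝ}

theorem Trans.prolong_iff {k : ℕ} {z w : Jet k} : φ.Prolong k z w ↔ ∃ x ∈ φ.dom,
    ∃ s t : ℝ → Fin 5 → ℝ, ContDiffOn ℝ ∞ s φ.dom ∧ ContDiffOn ℝ ∞ t (φ.f '' φ.dom) ∧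
      φ.Maps s t ∧ jet k s x = z ∧ jet k t (φ.f x) = w := by
  constructor
  · rintro ⟨hx, s, t, hs, ht, hm, h1, h2⟩
    exact ⟨z.1, hx, s, t, hs, ht, hm, h1, h2⟩
  · rintro ⟨x, hx, s, t, hs, ht, hm, rfl, rfl⟩
    exact ⟨hx, s, t, hs, ht, hm, rfl, rfl⟩

/-- The values at `0, ±1, ±2` already determine a quartic. -/
theorem quartic_coeff_eq_zero {p : Fin 5 → ℝ} (h : ∀ y, rhs p y = 0) : p = 0 := by
  have h0 := h 0
  have h1 := h 1
  have h2 := h (-1)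
  have h3 := h 2
  have h4 := h (-2)
  simp only [rhs] at h0 h1 h2 h3 h4
  funext i
  fin_cases i <;> simp <;> linarith

/-- The coefficients of the transform of an equation determine those of the equation. -/
theorem Trans.Maps.coeff (h : φ.Maps s t) (hx : x ∈ φ.dom) :
    s x 0 = deriv φ.f x * (t (φ.f x) 0 * φ.g x ^ 3) ∧
    s x 1 = deriv φ.f x * (4 * t (φ.f x) 0 * φ.g x ^ 2 * φ.h x + t (φ.f x) 1 * φ.g x ^ 2) ∧
    s x 2 = deriv φ.f x * (6 * t (φ.f x) 0 * φ.g x * φ.h x ^ 2 + 3 * t (φ.f x) 1 * φ.g x * φ.h x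
      + t (φ.f x) 2 * φ.g x) ∧
    s x 3 = deriv φ.f x * (4 * t (φ.f x) 0 * φ.h x ^ 3 + 3 * t (φ.f x) 1 * φ.h x ^ 2
      + 2 * t (φ.f x) 2 * φ.h x + t (φ.f x) 3) - deriv φ.g x / φ.g x ∧
    s x 4 = (deriv φ.f x * (t (φ.f x) 0 * φ.h x ^ 4 + t (φ.f x) 1 * φ.h x ^ 3
      + t (φ.f x) 2 * φ.h x ^ 2 + t (φ.f x) 3 * φ.h x + t (φ.f x) 4) - deriv φ.h x) / φ.g x := by
  have hf := (φ.deriv_f_pos x hx).ne'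
  have hg := φ.g_ne_zero x hx
  have hm := h x hx
  revert hm hf
  generalize deriv φ.f x = f1
  generalize deriv φ.g x = g1
  generalize deriv φ.h x = h1
  generalize φ.h x = h0
  revert hg
  generalize φ.g x = g0
  generalize t (φ.f x) = u
  generalize s x = v
  intro hg hf hm
  -- The entries are the coefficients in `y` of `f' * rhs u (g y + h) - g * rhs v y - g' y - h'`.
  have key := quartic_coeff_eq_zero (p := ![f1 * (u 0 * g0 ^ 4) - g0 * v 0,
    f1 * (4 * u 0 * g0 ^ 3 * h0 + u 1 * g0 ^ 3) - g0 * v 1,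
    f1 * (6 * u 0 * g0 ^ 2 * h0 ^ 2 + 3 * u 1 * g0 ^ 2 * h0 + u 2 * g0 ^ 2) - g0 * v 2,
    f1 * (4 * u 0 * g0 * h0 ^ 3 + 3 * u 1 * g0 * h0 ^ 2 + 2 * u 2 * g0 * h0 + u 3 * g0)
      - g0 * v 3 - g1,
    f1 * (u 0 * h0 ^ 4 + u 1 * h0 ^ 3 + u 2 * h0 ^ 2 + u 3 * h0 + u 4) - g0 * v 4 - h1]) (by
      intro y
      have := hm y
      rw [eq_div_iff hf] at this
      simp [rhs] at this ⊢
      linear_combination this)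
  have k0 := congrFun key 0
  have k1 := congrFun key 1
  have k2 := congrFun key 2
  have k3 := congrFun key 3
  have k4 := congrFun key 4
  simp at k0 k1 k2 k3 k4
  refine ⟨?_, ?_, ?_, ?_, ?_⟩
  · apply mul_left_cancel₀ hg; linear_combination -k0
  · apply mul_left_cancel₀ hg; linear_combination -k1
  · apply mul_left_cancel₀ hg; linear_combination -k2
  · field_simp; linear_combination -k3
  · field_simp; linear_combination -k4

theorem Trans.Maps.I0_eq (h : φ.Maps s t) (hx : x ∈ φ.dom) :
    s x 0 = deriv φ.f x * φ.g x ^ 3 * t (φ.f x) 0 := by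
  rw [(h.coeff hx).1]; ring

theorem Trans.Maps.I1_eq (h : φ.Maps s t) (hx : x ∈ φ.dom) :
    8 * s x 0 * s x 2 - 3 * s x 1 ^ 2 = deriv φ.f x ^ 2 * φ.g x ^ 4 *
      (8 * t (φ.f x) 0 * t (φ.f x) 2 - 3 * t (φ.f x) 1 ^ 2) := by
  obtain ⟨h0, h1, h2, -⟩ := h.coeff hx
  rw [h0, h1, h2]; ring

theorem Trans.Maps.regularAt_iff (h : φ.Maps s t) (hx : x ∈ φ.dom) :
    RegularAt s x ↔ RegularAt t (φ.f x) := by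
  have hf := (φ.deriv_f_pos x hx).ne'
  have hg := φ.g_ne_zero x hx
  unfold RegularAt
  rw [h.I1_eq hx, h.I0_eq hx]
  simp [hf, hg]

/-- `f ^ 2 * g ^ 4` is the square of `f * g ^ 2`, which is nonnegative whatever the sign of `g`;
half-integral powers of `|I1|` therefore scale without a sign ambiguity. -/
theorem abs_rpow_three_halves {f g I : ℝ} (hf : 0 < f) :
    |f ^ 2 * g ^ 4 * I| ^ (3 / 2 : ℝ) = f ^ 3 * g ^ 6 * |I| ^ (3 / 2 : ℝ) := by
  have : |f ^ 2 * g ^ 4 * I| = (f * g ^ 2) ^ (2 : ℝ) * |I| := by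
    rw [abs_mul, abs_of_nonneg (by positivity), Real.rpow_two]; ring
  rw [this, Real.mul_rpow (by positivity) (by positivity), ← Real.rpow_mul (by positivity)]
  norm_num
  left
  ring

theorem abs_rpow_five_halves {f g I : ℝ} (hf : 0 < f) :
    |f ^ 2 * g ^ 4 * I| ^ (5 / 2 : ℝ) = f ^ 5 * g ^ 10 * |I| ^ (5 / 2 : ℝ) := by
  have : |f ^ 2 * g ^ 4 * I| = (f * g ^ 2) ^ (2 : ℝ) * |I| := by
    rw [abs_mul, abs_of_nonneg (by positivity), Real.rpow_two]; ring
  rw [this, Real.mul_rpow (by positivity) (by positivity), ← Real.rpow_mul (by positivity)]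
  norm_num
  left
  ring

/-- `I0 ^ 2` contributes `f'^2 g^6` and `|I1|^(3/2)` contributes `f'^3 g^6`, so `g` cancels. This
identity is also the differential equation that `f` has to satisfy in the separation argument. -/
theorem Trans.Maps.weight_eq (h : φ.Maps s t) (hx : x ∈ φ.dom) (hr : RegularAt s x) :
    deriv φ.f x * weight s x = weight t (φ.f x) := by
  have hf := φ.deriv_f_pos x hx
  have hg := φ.g_ne_zero x hx
  have hI := abs_pos.2 (right_ne_zero_of_mul ((h.regularAt_iff hx).1 hr))
  unfold weight
  rw [h.I1_eq hx, h.I0_eq hx, abs_rpow_three_halves hf]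
  have := Real.rpow_pos_of_pos hI (3 / 2)
  field_simp

theorem Trans.isOpen_image (φ : Trans) : IsOpen (φ.f '' φ.dom) := by
  rw [isOpen_iff_mem_nhds]
  rintro _ ⟨x, hx, rfl⟩
  have hc := φ.smooth_f.contDiffAt (φ.isOpen_dom.mem_nhds hx)
  have hs := (hc.hasStrictDerivAt (by simp))
  rw [← hs.map_nhds_eq (φ.deriv_f_pos x hx).ne']
  exact image_mem_map (φ.isOpen_dom.mem_nhds hx)

/-- A function constant along the graph of the prolongation near a point has a total derivative
which is transformed by the factor `f'`. -/
theorem Trans.totalDeriv_eq (hs : ContDiffOn ℝ ∞ s φ.dom)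
    (ht : ContDiffOn ℝ ∞ t (φ.f '' φ.dom)) (hx : x ∈ φ.dom) {k : ℕ} {F F' : Jet k → ℝ}
    (hF : DifferentiableAt ℝ F (jet k t (φ.f x))) (hF' : DifferentiableAt ℝ F' (jet k s x))
    (he : ∀ᶠ y in 𝓝 x, F' (jet k s y) = F (jet k t (φ.f y))) :
    totalDeriv F' (jet (k + 1) s x) =
      deriv φ.f x * totalDeriv F (jet (k + 1) t (φ.f x)) := by
  have h1 := hasDerivAt_comp_jet φ.isOpen_dom hs hx hF'
  have h2 := (hasDerivAt_comp_jet φ.isOpen_image ht (mem_image_of_mem _ hx) hF).comp x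
    (φ.smooth_f.hasDerivAt_deriv φ.isOpen_dom hx)
  rw [mul_comm]
  exact (h1.congr_of_eventuallyEq (EventuallyEq.symm he)).unique h2

theorem Trans.Maps.nabla_eq (h : φ.Maps s t) (hs : ContDiffOn ℝ ∞ s φ.dom)
    (ht : ContDiffOn ℝ ∞ t (φ.f '' φ.dom)) (hx : x ∈ φ.dom) (hr : RegularAt s x)
    {k : ℕ} {F F' : Jet k → ℝ}
    (hF : DifferentiableAt ℝ F (jet k t (φ.f x))) (hF' : DifferentiableAt ℝ F' (jet k s x))
    (he : ∀ᶠ y in 𝓝 x, F' (jet k s y) = F (jet k t (φ.f y))) :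
    nabla F' (jet (k + 1) s x) = nabla F (jet (k + 1) t (φ.f x)) := by
  rw [nabla, nabla, weight_jet, weight_jet, Trans.totalDeriv_eq hs ht hx hF hF' he,
    ← h.weight_eq hx hr]
  ring

theorem nablaInvariant : NablaInvariant := by
  intro φ k F F' z w hz hzw hF hF' he
  obtain ⟨x, hx, s, t, hs, ht, hm, rfl, rfl⟩ := Trans.prolong_iff.1 hzw
  refine hm.nabla_eq hs ht hx ((jet_mem_regular _).1 hz) (hF.differentiableAt (by simp))
    (hF'.differentiableAt (by simp)) ?_
  have hc := (contDiffOn_jet φ.isOpen_dom hs k).continuousOn.continuousAt (φ.isOpen_dom.mem_nhds hx)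
  filter_upwards [hc.eventually he, φ.isOpen_dom.mem_nhds hx] with y hy hyd
  exact hy _ ⟨hyd, s, t, hs, ht, hm, rfl, rfl⟩

/-- Both jet curves stay in `U` near the given points, so the invariance of `I` is an identity along
them, which can be differentiated. -/
theorem IsDiffInvariant.nabla {k : ℕ} {U : Set (Jet k)} {I : Jet k → ℝ} (hU : IsOpen U)
    (hUr : U ⊆ regular k) (hI : IsDiffInvariant k U I) :
    IsDiffInvariant (k + 1) (proj (Nat.le_succ k) ⁻¹' U) (nabla I) := by
  refine ⟨contDiffOn_nabla hU hUr hI.1, ?_⟩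
  rintro z hz w hw ⟨φ, hzw⟩
  obtain ⟨x, hx, s, t, hs, ht, hm, rfl, rfl⟩ := Trans.prolong_iff.1 hzw
  have hd : ∀ y ∈ U, DifferentiableAt ℝ I y := fun y hy =>
    (hI.1.contDiffAt (hU.mem_nhds hy)).differentiableAt (by simp)
  refine hm.nabla_eq hs ht hx ((jet_mem_regular k).1 (hUr hz)) (hd _ hw) (hd _ hz) ?_
  have hc := (contDiffOn_jet φ.isOpen_dom hs k).continuousOn.continuousAt (φ.isOpen_dom.mem_nhds hx)
  have hc' := ((contDiffOn_jet φ.isOpen_image ht k).continuousOn.continuousAt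
    (φ.isOpen_image.mem_nhds (mem_image_of_mem _ hx))).comp
    (φ.smooth_f.continuousOn.continuousAt (φ.isOpen_dom.mem_nhds hx))
  filter_upwards [hc.eventually (hU.mem_nhds hz), hc'.eventually (hU.mem_nhds hw),
    φ.isOpen_dom.mem_nhds hx] with y hy hy' hyd
  exact hI.2 _ hy _ hy' ⟨φ, hyd, s, t, hs, ht, hm, rfl, rfl⟩

/-- The purely polynomial content of invariance: lower case is the original equation, upper case its
transform. No derivative of `d` or `e` occurs, so `g''` and `h''` never enter, and `f''`, `g'`, `h'`
cancel. -/
theorem relative_invariants_transform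
    {A B C D E A1 B1 C1 f1 f2 g g1 h h1 a b c d e a1 b1 c1 : ℝ} (hg : g ≠ 0)
    (ha : a = f1 * (A * g ^ 3)) (hb : b = f1 * (4 * A * g ^ 2 * h + B * g ^ 2))
    (hc : c = f1 * (6 * A * g * h ^ 2 + 3 * B * g * h + C * g))
    (hd : d = f1 * (4 * A * h ^ 3 + 3 * B * h ^ 2 + 2 * C * h + D) - g1 / g)
    (he : e = (f1 * (A * h ^ 4 + B * h ^ 3 + C * h ^ 2 + D * h + E) - h1) / g)
    (ha1 : a1 = A1 * f1 ^ 2 * g ^ 3 + A * f2 * g ^ 3 + 3 * A * f1 * g ^ 2 * g1)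
    (hb1 : b1 = f2 * (4 * A * g ^ 2 * h + B * g ^ 2) + f1 * (4 * A1 * f1 * g ^ 2 * h +
      8 * A * g * g1 * h + 4 * A * g ^ 2 * h1 + B1 * f1 * g ^ 2 + 2 * B * g * g1))
    (hc1 : c1 = f2 * (6 * A * g * h ^ 2 + 3 * B * g * h + C * g) + f1 * (6 * A1 * f1 * g * h ^ 2 +
      6 * A * g1 * h ^ 2 + 12 * A * g * h * h1 + 3 * B1 * f1 * g * h + 3 * B * g1 * h +
      3 * B * g * h1 + C1 * f1 * g + C * g1)) :
    (3 * (a * b1 - a1 * b) + a * c ^ 2 - 3 * a * b * d + 12 * a ^ 2 * e = f1 ^ 3 * g ^ 5 *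
      (3 * (A * B1 - A1 * B) + A * C ^ 2 - 3 * A * B * D + 12 * A ^ 2 * E)) ∧
    (8 * a * a1 * (4 * a * c - 3 * b ^ 2) + 24 * a ^ 2 * b * b1 - 32 * a ^ 3 * c1 - 3 * b ^ 5
      + 64 * a ^ 3 * c * d - 24 * a ^ 2 * b ^ 2 * d - 32 * a ^ 2 * b * c ^ 2
      + 20 * a * b ^ 3 * c = f1 ^ 5 * g ^ 10 *
      (8 * A * A1 * (4 * A * C - 3 * B ^ 2) + 24 * A ^ 2 * B * B1 - 32 * A ^ 3 * C1 - 3 * B ^ 5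
      + 64 * A ^ 3 * C * D - 24 * A ^ 2 * B ^ 2 * D - 32 * A ^ 2 * B * C ^ 2
      + 20 * A * B ^ 3 * C)) := by
  subst ha hb hc hd he ha1 hb1 hc1
  constructor
  · field_simp; ring
  · field_simp; ring

theorem jet_one_snd_one {O : Set ℝ} (hO : IsOpen O) (hs : ContDiffOn ℝ ∞ s O) (hx : x ∈ O)
    (α : Fin 5) : HasDerivAt (fun y => s y α) ((jet 1 s x).2 1 α) x := by
  have h := hasDerivAt_pi.1 (hs.hasDerivAt_deriv hO hx) α
  simpa [jet] using h

theorem Trans.Maps.relative_invariants (h : φ.Maps s t) (hs : ContDiffOn ℝ ∞ s φ.dom)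
    (ht : ContDiffOn ℝ ∞ t (φ.f '' φ.dom)) (hx : x ∈ φ.dom) :
    I2 (jet 1 s x) = deriv φ.f x ^ 3 * φ.g x ^ 5 * I2 (jet 1 t (φ.f x)) ∧
    I3 (jet 1 s x) = deriv φ.f x ^ 5 * φ.g x ^ 10 * I3 (jet 1 t (φ.f x)) := by
  obtain ⟨h0, h1, h2, h3, h4⟩ := h.coeff hx
  have hf := φ.smooth_f.hasDerivAt_deriv φ.isOpen_dom hx
  have hg := φ.smooth_g.hasDerivAt_deriv φ.isOpen_dom hx
  have hh := φ.smooth_h.hasDerivAt_deriv φ.isOpen_dom hx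
  have hf' := ((contDiffOn_infty_iff_deriv_of_isOpen φ.isOpen_dom).1 φ.smooth_f).2.hasDerivAt_deriv
    φ.isOpen_dom hx
  have hT := fun α => (jet_one_snd_one φ.isOpen_image ht (mem_image_of_mem _ hx) α).comp x hf
  have hS := fun α => jet_one_snd_one φ.isOpen_dom hs hx α
  have hev := φ.isOpen_dom.mem_nhds hx
  simp only [I2, I3, jet_snd_zero]
  refine relative_invariants_transform (φ.g_ne_zero x hx) (f2 := deriv (deriv φ.f) x)
    (g1 := deriv φ.g x) (h1 := deriv φ.h x) (h := φ.h x) h0 h1 h2 h3 h4 ?_ ?_ ?_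
  · refine (hS 0).unique (((hf'.mul ((hT 0).mul (hg.pow 3))).congr_of_eventuallyEq ?_).congr_deriv ?_)
    · filter_upwards [hev] with y hy using (h.coeff hy).1
    · simp; ring
  · refine (hS 1).unique (((hf'.mul (((((hT 0).const_mul 4).mul (hg.pow 2)).mul hh).add
      ((hT 1).mul (hg.pow 2)))).congr_of_eventuallyEq ?_).congr_deriv ?_)
    · filter_upwards [hev] with y hy using (h.coeff hy).2.1
    · simp; left; ring
  · refine (hS 2).unique (((hf'.mul ((((((hT 0).const_mul 6).mul hg).mul (hh.pow 2)).add
      ((((hT 1).const_mul 3).mul hg).mul hh)).add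
      ((hT 2).mul hg))).congr_of_eventuallyEq ?_).congr_deriv ?_)
    · filter_upwards [hev] with y hy using (h.coeff hy).2.2.1
    · simp; left; ring

theorem isDiffInvariant_J1 : IsDiffInvariant 1 (regular 1) J1 := by
  refine ⟨contDiffOn_J1, ?_⟩
  rintro z hz w hw ⟨φ, hzw⟩
  obtain ⟨x, hx, s, t, hs, ht, hm, rfl, rfl⟩ := Trans.prolong_iff.1 hzw
  have hf := φ.deriv_f_pos _ hx
  have hg := φ.g_ne_zero _ hx
  have hI := right_ne_zero_of_mul ((jet_mem_regular 1).1 hw)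
  rw [J1, J1, (hm.relative_invariants hs ht hx).1, I1_jet, I1_jet, hm.I1_eq hx, I0_jet, I0_jet,
    hm.I0_eq hx]
  field_simp

theorem isDiffInvariant_J2 : IsDiffInvariant 1 (regular 1) J2 := by
  refine ⟨contDiffOn_J2, ?_⟩
  rintro z hz w hw ⟨φ, hzw⟩
  obtain ⟨x, hx, s, t, hs, ht, hm, rfl, rfl⟩ := Trans.prolong_iff.1 hzw
  have hf := φ.deriv_f_pos _ hx
  have hg := φ.g_ne_zero _ hx
  have hI := abs_pos.2 (right_ne_zero_of_mul ((jet_mem_regular 1).1 hw))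
  rw [J2, J2, (hm.relative_invariants hs ht hx).2, I1_jet, I1_jet, hm.I1_eq hx,
    abs_rpow_five_halves hf]
  have := Real.rpow_pos_of_pos hI (5 / 2)
  field_simp

theorem SameOrbit.proj {k l : ℕ} (h : l ≤ k) {z w : Jet k} (hzw : SameOrbit k z w) :
    SameOrbit l (proj h z) (proj h w) := by
  obtain ⟨φ, hzw⟩ := hzw
  obtain ⟨x, hx, s, t, hs, ht, hm, rfl, rfl⟩ := Trans.prolong_iff.1 hzw
  exact ⟨φ, hx, s, t, hs, ht, hm, rfl, rfl⟩

theorem isDiffInvariant_nablaIter {F : Jet 1 → ℝ} (hF : IsDiffInvariant 1 (regular 1) F) (i : ℕ) :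
    IsDiffInvariant (i + 1) (regular (i + 1)) (nablaIter F i) := by
  induction i with
  | zero => exact hF
  | succ i ih => exact ih.nabla (isOpen_regular _) le_rfl

theorem isDiffInvariant_basic {k : ℕ} (j : Fin 2) (i : Fin k) :
    IsDiffInvariant k (regular k) fun z => basic k z j i := by
  refine ⟨contDiffOn_pi.1 (contDiffOn_pi.1 (contDiffOn_basic k) j) i, fun z hz w hw hzw => ?_⟩
  have h : IsDiffInvariant 1 (regular 1) (if j = 0 then J1 else J2) := by
    split_ifs
    exacts [isDiffInvariant_J1, isDiffInvariant_J2]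
  exact (isDiffInvariant_nablaIter h i).2 _ hz _ hw (hzw.proj _)

theorem SameOrbit.sign_I1_eq {k : ℕ} {z w : Jet k} (hzw : SameOrbit k z w) :
    SignType.sign (I1 z) = SignType.sign (I1 w) := by
  obtain ⟨φ, hzw⟩ := hzw
  obtain ⟨x, hx, s, t, hs, ht, hm, rfl, rfl⟩ := Trans.prolong_iff.1 hzw
  have hf := φ.deriv_f_pos _ hx
  have hg : 0 < φ.g x ^ 4 := by have := φ.g_ne_zero _ hx; positivity
  rw [I1_jet, I1_jet, hm.I1_eq hx, sign_mul, sign_pos (by positivity), one_mul]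

theorem SameOrbit.basic_eq {k : ℕ} {z w : Jet k} (hzw : SameOrbit k z w) (hz : z ∈ regular k)
    (hw : w ∈ regular k) : basic k z = basic k w := by
  funext j i
  exact (isDiffInvariant_basic j i).2 z hz w hw hzw

end Invariance


/-! ### Affine dependence of the basic invariants on `d`, `e`, and their right inverses. -/

section Generators

variable {s t : ℝ → Fin 5 → ℝ} {O : Set ℝ} {x x₀ : ℝ} {k : ℕ}

/-- The polynomial section with prescribed derivatives at `x₀`. -/
noncomputable def taylorSection (x₀ : ℝ) (v : Fin (k + 1) → Fin 5 → ℝ) (x : ℝ) : Fin 5 → ℝ :=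
  ∑ i : Fin (k + 1), ((x - x₀) ^ (i : ℕ) / ((i : ℕ).factorial : ℝ)) • v i

theorem contDiff_taylorSection (x₀ : ℝ) (v : Fin (k + 1) → Fin 5 → ℝ) :
    ContDiff ℝ ∞ (taylorSection x₀ v) := by
  unfold taylorSection
  fun_prop

theorem iteratedDeriv_taylorSection (x₀ : ℝ) (v : Fin (k + 1) → Fin 5 → ℝ) (i : Fin (k + 1)) :
    iteratedDeriv i (taylorSection x₀ v) x₀ = v i := by
  unfold taylorSection
  rw [iteratedDeriv_fun_sum fun j _ => ContDiff.contDiffAt (by fun_prop)]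
  simp_rw [iteratedDeriv_sub_pow_smul]
  simp [Fin.val_inj]

theorem jet_taylorSection (z : Jet k) : jet k (taylorSection z.1 z.2) z.1 = z :=
  Prod.ext rfl (funext fun i => iteratedDeriv_taylorSection z.1 z.2 i)

theorem taylorSection_add (x₀ : ℝ) (v w : Fin (k + 1) → Fin 5 → ℝ) :
    taylorSection x₀ (v + w) = taylorSection x₀ v + taylorSection x₀ w := by
  funext x
  simp [taylorSection, Finset.sum_add_distrib]

theorem taylorSection_smul (x₀ c : ℝ) (v : Fin (k + 1) → Fin 5 → ℝ) :
    taylorSection x₀ (c • v) = c • taylorSection x₀ v := by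
  funext x
  simp only [taylorSection, Pi.smul_apply, Finset.smul_sum]
  exact Finset.sum_congr rfl fun i _ => smul_comm _ _ _

theorem isOpen_setOf_regularAt (hO : IsOpen O) (hs : ContinuousOn s O) :
    IsOpen (O ∩ {x | RegularAt s x}) := by
  have hc := continuousOn_pi.1 hs
  exact ((hc 0).mul (((continuousOn_const.mul (hc 0)).mul (hc 2)).sub
    (continuousOn_const.mul ((hc 1).pow 2)))).isOpen_inter_preimage hO isOpen_ne

/-- The variation of `J₁` and `J₂` along a section `s` when the coefficients `d`, `e` are varied
by `σ 3`, `σ 4`. -/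
noncomputable def variation (s σ : ℝ → Fin 5 → ℝ) (j : Fin 2) (x : ℝ) : ℝ :=
  if j = 0 then
    (12 * s x 0 ^ 2 * σ x 4 - 3 * s x 0 * s x 1 * σ x 3) * s x 0 /
      (8 * s x 0 * s x 2 - 3 * s x 1 ^ 2) ^ 2
  else
    8 * s x 0 ^ 2 * (8 * s x 0 * s x 2 - 3 * s x 1 ^ 2) * σ x 3 /
      |8 * s x 0 * s x 2 - 3 * s x 1 ^ 2| ^ (5 / 2 : ℝ)

theorem variation_add (s σ τ : ℝ → Fin 5 → ℝ) (j : Fin 2) :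
    variation s (σ + τ) j = variation s σ j + variation s τ j := by
  funext x
  simp only [variation, Pi.add_apply]
  split_ifs <;> ring

theorem variation_smul (s σ : ℝ → Fin 5 → ℝ) (c : ℝ) (j : Fin 2) :
    variation s (c • σ) j = c • variation s σ j := by
  funext x
  simp only [variation, Pi.smul_apply, smul_eq_mul]
  split_ifs <;> ring

theorem contDiffOn_variation {σ : ℝ → Fin 5 → ℝ} (hs : ContDiffOn ℝ ∞ s O)
    (hr : ∀ x ∈ O, RegularAt s x) (hσ : ContDiffOn ℝ ∞ σ O) (j : Fin 2) :
    ContDiffOn ℝ ∞ (variation s σ j) O := by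
  have hc := contDiffOn_pi.1 hs
  have hd := contDiffOn_pi.1 hσ
  have hI : ContDiffOn ℝ ∞ (fun x => 8 * s x 0 * s x 2 - 3 * s x 1 ^ 2) O :=
    ((contDiffOn_const.mul (hc 0)).mul (hc 2)).sub (contDiffOn_const.mul ((hc 1).pow 2))
  have hI0 : ∀ x ∈ O, 8 * s x 0 * s x 2 - 3 * s x 1 ^ 2 ≠ 0 :=
    fun x hx => right_ne_zero_of_mul (hr x hx)
  unfold variation
  split_ifs
  · exact ((((contDiffOn_const.mul ((hc 0).pow 2)).mul (hd 4)).sub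
      (((contDiffOn_const.mul (hc 0)).mul (hc 1)).mul (hd 3))).mul (hc 0)).div (hI.pow 2)
      fun x hx => pow_ne_zero 2 (hI0 x hx)
  · exact (((contDiffOn_const.mul ((hc 0).pow 2)).mul hI).mul (hd 3)).div
      (fun x hx => ContDiffAt.comp_contDiffWithinAt (g := fun y : ℝ => |y| ^ (5 / 2 : ℝ)) x
        (contDiffAt_abs_rpow (hI0 x hx)) (hI x hx))
      fun x hx => (Real.rpow_pos_of_pos (abs_pos.2 (hI0 x hx)) _).ne'

/-- Two sections with the same coefficients `a`, `b`, `c`. -/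
def SameLeading (s t : ℝ → Fin 5 → ℝ) (O : Set ℝ) : Prop :=
  ∀ x ∈ O, s x 0 = t x 0 ∧ s x 1 = t x 1 ∧ s x 2 = t x 2

theorem SameLeading.regularAt_iff (h : SameLeading s t O) (hx : x ∈ O) :
    RegularAt s x ↔ RegularAt t x := by
  obtain ⟨h0, h1, h2⟩ := h x hx
  rw [RegularAt, RegularAt, h0, h1, h2]

theorem SameLeading.weight_eqOn (h : SameLeading s t O) : EqOn (weight s) (weight t) O := by
  intro x hx
  obtain ⟨h0, h1, h2⟩ := h x hx
  rw [weight, weight, h0, h1, h2]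

/-- `d` and `e` enter `I2` and `I3` undifferentiated and to first degree, so the difference is
exactly linear in `s - t`, with no remainder. -/
theorem SameLeading.J_jet (h : SameLeading s t O) (hO : IsOpen O) (hs : ContDiffOn ℝ ∞ s O)
    (ht : ContDiffOn ℝ ∞ t O) (hr : ∀ x ∈ O, RegularAt t x) (j : Fin 2) :
    EqOn (fun x => (if j = 0 then J1 else J2) (jet 1 s x))
      ((fun x => (if j = 0 then J1 else J2) (jet 1 t x)) + variation t (s - t) j) O := by
  intro x hx
  obtain ⟨h0, h1, h2⟩ := h x hx
  have hI := right_ne_zero_of_mul (hr x hx)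
  have hI' := Real.rpow_pos_of_pos (abs_pos.2 hI) (5 / 2)
  have hev := hO.mem_nhds hx
  have e0 : (jet 1 s x).2 1 0 = (jet 1 t x).2 1 0 :=
    (jet_one_snd_one hO hs hx 0).unique ((jet_one_snd_one hO ht hx 0).congr_of_eventuallyEq
      (by filter_upwards [hev] with y hy using (h y hy).1))
  have e1 : (jet 1 s x).2 1 1 = (jet 1 t x).2 1 1 :=
    (jet_one_snd_one hO hs hx 1).unique ((jet_one_snd_one hO ht hx 1).congr_of_eventuallyEq
      (by filter_upwards [hev] with y hy using (h y hy).2.1))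
  have e2 : (jet 1 s x).2 1 2 = (jet 1 t x).2 1 2 :=
    (jet_one_snd_one hO hs hx 2).unique ((jet_one_snd_one hO ht hx 2).congr_of_eventuallyEq
      (by filter_upwards [hev] with y hy using (h y hy).2.2))
  simp only [Pi.add_apply, variation, Pi.sub_apply]
  split_ifs
  · simp only [J1, I0_jet, I1_jet, I2, e0, e1, jet_snd_zero, h0, h1, h2]
    field_simp
    ring
  · simp only [J2, I1_jet, I3, e0, e1, e2, jet_snd_zero, h0, h1, h2]
    field_simp
    ring

/-- The coefficient of `∇` involves only `a`, `b`, `c`, so the same linear operator acts along both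
sections. -/
theorem SameLeading.basic_jet (h : SameLeading s t O) (hO : IsOpen O) (hs : ContDiffOn ℝ ∞ s O)
    (ht : ContDiffOn ℝ ∞ t O) (hr : ∀ x ∈ O, RegularAt t x) (hx : x ∈ O) (j : Fin 2)
    (i : Fin k) :
    basic k (jet k s x) j i = basic k (jet k t x) j i +
      (dop (weight t))^[i] (variation t (s - t) j) x := by
  have hF : ContDiffOn ℝ ∞ (if j = 0 then J1 else J2) (regular 1) := by
    split_ifs
    exacts [contDiffOn_J1, contDiffOn_J2]
  rw [GenAbel.basic_jet hO hs (fun y hy => (h.regularAt_iff hy).2 (hr y hy)) hx,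
    GenAbel.basic_jet hO ht hr hx, dop_iterate_congr hO h.weight_eqOn (h.J_jet hO hs ht hr j) i hx]
  exact dop_iterate_add hO (contDiffOn_weight ht hr)
    (hF.comp (contDiffOn_jet hO ht 1) fun y hy => (jet_mem_regular 1).2 (hr y hy))
    (contDiffOn_variation ht hr (hs.sub ht) j) i hx

/-- The system is triangular: the variation of `J2` is a nonvanishing multiple of `σ 3`, and that of
`J1` then yields `σ 4` because its coefficient `12 a^3 / I1^2` does not vanish. -/
theorem isBigO_pow_of_variation {σ : ℝ → Fin 5 → ℝ} (hO : IsOpen O)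
    (ht : ContDiffOn ℝ ∞ t O) (hr : ∀ x ∈ O, RegularAt t x) (hσ : ContDiffOn ℝ ∞ σ O)
    (h0 : SameLeading σ 0 O) (hx₀ : x₀ ∈ O)
    (h : ∀ (j : Fin 2) (i : Fin k), (dop (weight t))^[i] (variation t σ j) x₀ = 0) :
    σ =O[𝓝 x₀] fun x => (x - x₀) ^ k := by
  have hev := hO.mem_nhds hx₀
  have hv : ∀ j, variation t σ j =O[𝓝 x₀] fun x => (x - x₀) ^ k := fun j =>
    isBigO_pow_of_dop_iterate hO hx₀ (contDiffOn_weight ht hr) (hr x₀ hx₀).weight_pos.ne' k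
      (contDiffOn_variation ht hr hσ j) fun i hi => h j ⟨i, hi⟩
  have hc : ∀ α, ContinuousAt (fun x => t x α) x₀ := fun α =>
    (contDiffOn_pi.1 ht α).continuousOn.continuousAt hev
  have ha := left_ne_zero_of_mul (hr x₀ hx₀)
  have hI := right_ne_zero_of_mul (hr x₀ hx₀)
  have hcI : ContinuousAt (fun x => 8 * t x 0 * t x 2 - 3 * t x 1 ^ 2) x₀ :=
    ((continuousAt_const.mul (hc 0)).mul (hc 2)).sub (continuousAt_const.mul ((hc 1).pow 2))
  have h3 : (fun x => σ x 3) =O[𝓝 x₀] fun x => (x - x₀) ^ k := by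
    have hb : ContinuousAt (fun x => |8 * t x 0 * t x 2 - 3 * t x 1 ^ 2| ^ (5 / 2 : ℝ) /
        (8 * t x 0 ^ 2 * (8 * t x 0 * t x 2 - 3 * t x 1 ^ 2))) x₀ :=
      (hcI.abs.rpow_const (Or.inr (by norm_num))).div
        ((continuousAt_const.mul ((hc 0).pow 2)).mul hcI) (by simp [ha, hI])
    refine ((hb.isBigO_one ℝ).mul (hv 1)).congr' ?_ (by simp)
    filter_upwards [hev] with x hx
    have hI := right_ne_zero_of_mul (hr x hx)
    have ha := left_ne_zero_of_mul (hr x hx)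
    have hI' := Real.rpow_pos_of_pos (abs_pos.2 hI) (5 / 2)
    simp only [variation, one_ne_zero, if_false]
    field_simp
  have h4 : (fun x => σ x 4) =O[𝓝 x₀] fun x => (x - x₀) ^ k := by
    have hb : ContinuousAt (fun x => (8 * t x 0 * t x 2 - 3 * t x 1 ^ 2) ^ 2 /
        (12 * t x 0 ^ 3)) x₀ :=
      (hcI.pow 2).div (continuousAt_const.mul ((hc 0).pow 3)) (by simp [ha])
    have hb' : ContinuousAt (fun x => t x 1 / (4 * t x 0)) x₀ :=
      (hc 1).div (continuousAt_const.mul (hc 0)) (by simp [ha])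
    refine (((hb.isBigO_one ℝ).mul (hv 0)).add ((hb'.isBigO_one ℝ).mul h3)).congr' ?_ (by simp)
    filter_upwards [hev] with x hx
    have hI := right_ne_zero_of_mul (hr x hx)
    have ha := left_ne_zero_of_mul (hr x hx)
    simp only [variation, if_true]
    field_simp
    ring
  refine isBigO_pi.2 fun α => ?_
  have hz : ∀ α : Fin 5, (∀ x ∈ O, σ x α = 0) → (fun x => σ x α) =O[𝓝 x₀]
      fun x => (x - x₀) ^ k := fun α hα => by
    refine (isBigO_zero (fun x => (x - x₀) ^ k) (𝓝 x₀)).congr' ?_ EventuallyEq.rfl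
    filter_upwards [hev] with x hx using (hα x hx).symm
  fin_cases α
  exacts [hz 0 fun x hx => (h0 x hx).1, hz 1 fun x hx => (h0 x hx).2.1,
    hz 2 fun x hx => (h0 x hx).2.2, h3, h4]

/-- Sections with the same `a`, `b`, `c` and the same basic invariants of order at most `k` at a
regular point agree there to order `k - 1`. -/
theorem SameLeading.isBigO_sub (h : SameLeading s t O) (hO : IsOpen O) (hs : ContDiffOn ℝ ∞ s O)
    (ht : ContDiffOn ℝ ∞ t O) (hr : ∀ x ∈ O, RegularAt t x) (hx₀ : x₀ ∈ O)
    (hb : basic k (jet k s x₀) = basic k (jet k t x₀)) :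
    (s - t) =O[𝓝 x₀] fun x => (x - x₀) ^ k := by
  refine isBigO_pow_of_variation hO ht hr (hs.sub ht) (fun x hx => ?_) hx₀ fun j i => ?_
  · obtain ⟨h0, h1, h2⟩ := h x hx
    simp [h0, h1, h2]
  · have := h.basic_jet hO hs ht hr hx₀ j i
    rw [hb] at this
    linarith

/-- The jets in which only the derivatives of `d` and `e` of order less than `k` are nonzero. -/
def lowerJet (k : ℕ) : (Fin 2 → Fin k → ℝ) →ₗ[ℝ] (Fin (k + 1) → Fin 5 → ℝ) where
  toFun δ i α :=
    if h : (i : ℕ) < k then (if α = 3 then δ 1 ⟨i, h⟩ else if α = 4 then δ 0 ⟨i, h⟩ else 0) else 0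
  map_add' δ ε := by
    funext i α
    simp only [Pi.add_apply]
    split_ifs <;> simp
  map_smul' c δ := by
    funext i α
    simp only [Pi.smul_apply, RingHom.id_apply]
    split_ifs <;> simp

theorem taylorSection_lowerJet (x₀ : ℝ) (δ : Fin 2 → Fin k → ℝ) (x : ℝ) :
    taylorSection x₀ (lowerJet k δ) x 0 = 0 ∧ taylorSection x₀ (lowerJet k δ) x 1 = 0 ∧
      taylorSection x₀ (lowerJet k δ) x 2 = 0 := by
  refine ⟨?_, ?_, ?_⟩ <;>
  · simp only [taylorSection, lowerJet, LinearMap.coe_mk, AddHom.coe_mk, Finset.sum_apply,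
      Pi.smul_apply]
    refine Finset.sum_eq_zero fun i _ => ?_
    simp

theorem regularAt_taylorSection {z : Jet k} :
    RegularAt (taylorSection z.1 z.2) z.1 ↔ z ∈ regular k := by
  rw [← jet_mem_regular k, jet_taylorSection]

/-- The linear part of the basic invariants as functions of the lower derivatives of `d`, `e`. -/
noncomputable def lowerLinear (z : Jet k) (hz : z ∈ regular k) :
    (Fin 2 → Fin k → ℝ) →ₗ[ℝ] (Fin 2 → Fin k → ℝ) where
  toFun δ j i := (dop (weight (taylorSection z.1 z.2)))^[i]
    (variation (taylorSection z.1 z.2) (taylorSection z.1 (lowerJet k δ)) j) z.1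
  map_add' δ ε := by
    -- The polynomial section need not be regular everywhere; the weight is smooth on the open set
    -- where it is.
    have hs := (contDiff_taylorSection z.1 z.2).contDiffOn (s := univ ∩ {x | RegularAt (taylorSection z.1 z.2) x})
    funext j i
    rw [map_add, taylorSection_add, variation_add]
    exact dop_iterate_add
      (isOpen_setOf_regularAt isOpen_univ (contDiff_taylorSection z.1 z.2).continuous.continuousOn)
      (contDiffOn_weight hs fun x hx => hx.2)
      (contDiffOn_variation hs (fun x hx => hx.2) (contDiff_taylorSection _ _).contDiffOn j)
      (contDiffOn_variation hs (fun x hx => hx.2) (contDiff_taylorSection _ _).contDiffOn j) i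
      ⟨mem_univ _, regularAt_taylorSection.2 hz⟩
  map_smul' c δ := by
    have hs := (contDiff_taylorSection z.1 z.2).contDiffOn (s := univ ∩ {x | RegularAt (taylorSection z.1 z.2) x})
    funext j i
    rw [map_smul, taylorSection_smul, variation_smul]
    exact dop_iterate_const_smul
      (isOpen_setOf_regularAt isOpen_univ (contDiff_taylorSection z.1 z.2).continuous.continuousOn)
      (contDiffOn_weight hs fun x hx => hx.2)
      (contDiffOn_variation hs (fun x hx => hx.2) (contDiff_taylorSection _ _).contDiffOn j) c i
      ⟨mem_univ _, regularAt_taylorSection.2 hz⟩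

/-- The two Taylor sections share `a`, `b`, `c` identically and differ by the Taylor section of
`lowerJet k δ`, so the affine formula for sections applies at `z.1`. -/
theorem basic_add_lowerJet {z : Jet k} (hz : z ∈ regular k) (δ : Fin 2 → Fin k → ℝ) :
    basic k (z.1, z.2 + lowerJet k δ) = basic k z + lowerLinear z hz δ := by
  have hs := (contDiff_taylorSection z.1 z.2).contDiffOn (s := univ ∩ {x | RegularAt (taylorSection z.1 z.2) x})
  have hO := isOpen_setOf_regularAt isOpen_univ
    (contDiff_taylorSection z.1 z.2).continuous.continuousOn
  have hL : SameLeading (taylorSection z.1 (z.2 + lowerJet k δ)) (taylorSection z.1 z.2)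
      (univ ∩ {x | RegularAt (taylorSection z.1 z.2) x}) := fun x _ => by
    obtain ⟨h0, h1, h2⟩ := taylorSection_lowerJet z.1 δ x
    simp [taylorSection_add, h0, h1, h2]
  funext j i
  have := hL.basic_jet (k := k) hO (contDiff_taylorSection _ _).contDiffOn hs (fun x hx => hx.2)
    ⟨mem_univ _, regularAt_taylorSection.2 hz⟩ j i
  rw [jet_taylorSection] at this
  have hj := jet_taylorSection ((z.1, z.2 + lowerJet k δ) : Jet k)
  dsimp only at hj
  rw [hj, taylorSection_add, add_sub_cancel_left] at this
  exact this

/-- If all variations vanish, the Taylor section of `lowerJet k δ` is `O((x - z.1)^k)`, so its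
derivatives of order `< k`, which are the entries of `δ`, are zero. -/
theorem lowerLinear_injective {z : Jet k} (hz : z ∈ regular k) :
    Function.Injective (lowerLinear z hz) := by
  rw [injective_iff_map_eq_zero]
  intro δ hδ
  have hs := (contDiff_taylorSection z.1 z.2).contDiffOn (s := univ ∩ {x | RegularAt (taylorSection z.1 z.2) x})
  have hO := isOpen_setOf_regularAt isOpen_univ
    (contDiff_taylorSection z.1 z.2).continuous.continuousOn
  have h1 := isBigO_pow_of_variation (k := k) hO hs (fun x hx => hx.2)
    (contDiff_taylorSection z.1 (lowerJet k δ)).contDiffOn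
    (fun x _ => taylorSection_lowerJet z.1 δ x)
    ⟨mem_univ _, regularAt_taylorSection.2 hz⟩ (fun j i => congrFun (congrFun hδ j) i)
  have h2 := iteratedDeriv_eq_zero_of_isBigO_pow isOpen_univ (mem_univ _)
    (contDiff_taylorSection z.1 (lowerJet k δ)).contDiffOn h1
  have h3 : ∀ i : Fin k, lowerJet k δ i.castSucc = 0 := fun i => by
    rw [← iteratedDeriv_taylorSection z.1 (lowerJet k δ)]
    exact h2 i i.isLt
  funext j i
  have h4 := congrFun (h3 i)
  fin_cases j
  · simpa [lowerJet] using h4 4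
  · simpa [lowerJet] using h4 3

/-- The basic invariants have smooth local sections through every regular jet. -/
theorem exists_local_section_basic {z : Jet k} (hz : z ∈ regular k) :
    ∃ q : (Fin 2 → Fin k → ℝ) → Jet k, ContDiff ℝ ∞ q ∧ q (basic k z) = z ∧
      ∀ v, basic k (q v) = v := by
  -- There are as many invariants as free derivatives, `2k` of each, so injectivity gives
  -- invertibility; solving the affine equation `basic = v` starting from `z` gives `q`.
  let M := LinearEquiv.ofInjectiveEndo (lowerLinear z hz) (lowerLinear_injective hz)
  let N : (Fin 2 → Fin k → ℝ) →L[ℝ] (Fin (k + 1) → Fin 5 → ℝ) :=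
    LinearMap.toContinuousLinearMap (lowerJet k ∘ₗ M.symm.toLinearMap)
  refine ⟨fun v => (z.1, z.2 + N (v - basic k z)), ?_, ?_, fun v => ?_⟩
  · fun_prop
  · simp
  · have h : lowerLinear z hz (M.symm (v - basic k z)) = v - basic k z :=
      M.apply_symm_apply (v - basic k z)
    have := basic_add_lowerJet hz (M.symm (v - basic k z))
    rw [h, add_sub_cancel] at this
    exact this

end Generators


/-! ### Local diffeomorphisms of the line solving a separable equation. -/

section LocalDiffeomorphisms

theorem exists_primitive {u : ℝ → ℝ} {x₀ r : ℝ} (hr : 0 < r)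
    (hu : ContDiffOn ℝ ∞ u (Metric.ball x₀ r)) :
    ∃ γ : ℝ → ℝ, γ x₀ = 0 ∧ ContDiffOn ℝ ∞ γ (Metric.ball x₀ r) ∧
      ∀ x ∈ Metric.ball x₀ r, HasDerivAt γ (u x) x := by
  have hd : ∀ x ∈ Metric.ball x₀ r, HasDerivAt (fun y => ∫ z in x₀..y, u z) (u x) x := by
    intro x hx
    refine intervalIntegral.integral_hasDerivAt_right ?_ ?_ ?_
    · refine (hu.continuousOn.mono ?_).intervalIntegrable
      exact (convex_ball x₀ r).ordConnected.uIcc_subset (Metric.mem_ball_self hr) hx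
    · exact hu.continuousOn.stronglyMeasurableAtFilter Metric.isOpen_ball x hx
    · exact hu.continuousOn.continuousAt (Metric.isOpen_ball.mem_nhds hx)
  refine ⟨fun x => ∫ z in x₀..x, u z, by simp, ?_, hd⟩
  rw [contDiffOn_infty_iff_deriv_of_isOpen Metric.isOpen_ball]
  exact ⟨fun x hx => (hd x hx).differentiableAt.differentiableWithinAt,
    hu.congr fun x hx => (hd x hx).deriv⟩

/-- A local diffeomorphism of the line with prescribed positive derivative. -/
theorem exists_diffeo_of_deriv {u : ℝ → ℝ} {O : Set ℝ} {x₀ : ℝ} (hO : IsOpen O) (hx₀ : x₀ ∈ O)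
    (hu : ContDiffOn ℝ ∞ u O) (hpos : ∀ x ∈ O, 0 < u x) :
    ∃ e : OpenPartialHomeomorph ℝ ℝ, x₀ ∈ e.source ∧ e.source ⊆ O ∧ e x₀ = 0 ∧
      ContDiffOn ℝ ∞ e e.source ∧ ContDiffOn ℝ ∞ e.symm e.target ∧
      ∀ x ∈ e.source, HasDerivAt e (u x) x := by
  obtain ⟨r, hr, hrO⟩ := Metric.isOpen_iff.1 hO x₀ hx₀
  obtain ⟨γ, hγ0, hγ, hγd⟩ := exists_primitive hr (hu.mono hrO)
  have hx₀r : x₀ ∈ Metric.ball x₀ r := Metric.mem_ball_self hr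
  have hc : ContDiffAt ℝ ∞ γ x₀ := hγ.contDiffAt (Metric.isOpen_ball.mem_nhds hx₀r)
  have hd := (hγd x₀ hx₀r).hasFDerivAt_equiv (hpos x₀ hx₀).ne'
  let e := (hc.toOpenPartialHomeomorph γ hd (by simp)).restrOpen _
    (Metric.isOpen_ball (x := x₀) (ε := r))
  have hsrc : e.source ⊆ Metric.ball x₀ r := inter_subset_right
  have hed : ∀ x ∈ e.source, HasDerivAt e (u x) x := fun x hx => hγd x (hsrc hx)
  refine ⟨e, ⟨hc.mem_toOpenPartialHomeomorph_source hd (by simp), hx₀r⟩, hsrc.trans hrO, hγ0,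
    hγ.mono hsrc, fun y hy => ?_, hed⟩
  have hy' := e.map_target hy
  exact (e.contDiffAt_symm_deriv (hpos _ (hrO (hsrc hy'))).ne' hy (hed _ hy')
    (hγ.contDiffAt (Metric.isOpen_ball.mem_nhds (hsrc hy')))).contDiffWithinAt

/-- Separate variables: with `e₁`, `e₂` primitives of `1/p`, `1/q` vanishing at `x₀`, `y₀`, the
solution is `e₂⁻¹ ∘ e₁`. -/
theorem exists_diffeo_of_ode {p q : ℝ → ℝ} {O P : Set ℝ} {x₀ y₀ : ℝ} (hO : IsOpen O)
    (hP : IsOpen P) (hx₀ : x₀ ∈ O) (hy₀ : y₀ ∈ P) (hp : ContDiffOn ℝ ∞ p O)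
    (hq : ContDiffOn ℝ ∞ q P) (hp0 : ∀ x ∈ O, 0 < p x) (hq0 : ∀ y ∈ P, 0 < q y) :
    ∃ e : OpenPartialHomeomorph ℝ ℝ, x₀ ∈ e.source ∧ e.source ⊆ O ∧ e.target ⊆ P ∧ e x₀ = y₀ ∧
      ContDiffOn ℝ ∞ e e.source ∧ ContDiffOn ℝ ∞ e.symm e.target ∧
      ∀ x ∈ e.source, HasDerivAt e (q (e x) / p x) x := by
  obtain ⟨e₁, hm₁, hs₁, h₁, hc₁, hi₁, hd₁⟩ := exists_diffeo_of_deriv hO hx₀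
    (hp.inv fun x hx => (hp0 x hx).ne') fun x hx => inv_pos.2 (hp0 x hx)
  obtain ⟨e₂, hm₂, hs₂, h₂, hc₂, hi₂, hd₂⟩ := exists_diffeo_of_deriv hP hy₀
    (hq.inv fun x hx => (hq0 x hx).ne') fun x hx => inv_pos.2 (hq0 x hx)
  have hsrc : ∀ x, x ∈ (e₁.trans e₂.symm).source ↔ x ∈ e₁.source ∧ e₁ x ∈ e₂.target := fun x => by
    rw [OpenPartialHomeomorph.trans_source]; rfl
  have htgt : ∀ x, x ∈ (e₁.trans e₂.symm).target ↔ x ∈ e₂.source ∧ e₂ x ∈ e₁.target := fun x => by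
    rw [OpenPartialHomeomorph.trans_target]; rfl
  have h0 : e₁ x₀ ∈ e₂.target := by
    rw [h₁, ← h₂]
    exact e₂.map_source hm₂
  refine ⟨e₁.trans e₂.symm, (hsrc x₀).2 ⟨hm₁, h0⟩, fun x hx => hs₁ ((hsrc x).1 hx).1,
    fun x hx => hs₂ ((htgt x).1 hx).1, ?_, ?_, ?_, fun x hx => ?_⟩
  · change e₂.symm (e₁ x₀) = y₀
    rw [h₁, ← h₂, e₂.left_inv hm₂]
  · exact hi₂.comp (hc₁.mono fun x hx => ((hsrc x).1 hx).1) fun x hx => ((hsrc x).1 hx).2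
  · exact hi₁.comp (hc₂.mono fun x hx => ((htgt x).1 hx).1) fun x hx => ((htgt x).1 hx).2
  · obtain ⟨hx1, hx2⟩ := (hsrc x).1 hx
    have hm := e₂.map_target hx2
    have h := e₂.hasDerivAt_symm hx2 (inv_pos.2 (hq0 _ (hs₂ hm))).ne' (hd₂ _ hm)
    rw [inv_inv] at h
    exact h.comp x (hd₁ x hx1)

end LocalDiffeomorphisms

/-! ### Explicit transforms of equations. -/

section Pushforward

/-- The coefficients of the transformed equation, in terms of those of the original equation and
of `f'`, `g`, `g'`, `h`, `h'`. -/
noncomputable def push (v : Fin 5 → ℝ) (f1 g g1 h h1 : ℝ) : Fin 5 → ℝ :=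
  let A := v 0 / (f1 * g ^ 3)
  let B := v 1 / (f1 * g ^ 2) - 4 * A * h
  let C := v 2 / (f1 * g) - 6 * A * h ^ 2 - 3 * B * h
  let D := (v 3 + g1 / g) / f1 - 4 * A * h ^ 3 - 3 * B * h ^ 2 - 2 * C * h
  ![A, B, C, D, (g * v 4 + h1) / f1 - (A * h ^ 4 + B * h ^ 3 + C * h ^ 2 + D * h)]

variable (v : Fin 5 → ℝ) (f1 g g1 h h1 : ℝ)

theorem push_zero : push v f1 g g1 h h1 0 = v 0 / (f1 * g ^ 3) := rfl

theorem push_one : push v f1 g g1 h h1 1 =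
    v 1 / (f1 * g ^ 2) - 4 * push v f1 g g1 h h1 0 * h := rfl

theorem push_two : push v f1 g g1 h h1 2 =
    v 2 / (f1 * g) - 6 * push v f1 g g1 h h1 0 * h ^ 2 - 3 * push v f1 g g1 h h1 1 * h := rfl

theorem push_three : push v f1 g g1 h h1 3 =
    (v 3 + g1 / g) / f1 - 4 * push v f1 g g1 h h1 0 * h ^ 3 -
      3 * push v f1 g g1 h h1 1 * h ^ 2 - 2 * push v f1 g g1 h h1 2 * h := rfl

theorem push_four : push v f1 g g1 h h1 4 =
    (g * v 4 + h1) / f1 - (push v f1 g g1 h h1 0 * h ^ 4 + push v f1 g g1 h h1 1 * h ^ 3 +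
      push v f1 g g1 h h1 2 * h ^ 2 + push v f1 g g1 h h1 3 * h) := rfl

theorem rhs_push (y : ℝ) (hf : f1 ≠ 0) (hg : g ≠ 0) :
    rhs (push v f1 g g1 h h1) (g * y + h) = (g * rhs v y + g1 * y + h1) / f1 := by
  simp only [rhs, push_four, push_three, push_two, push_one, push_zero]
  field_simp
  ring

/-- Here `P`, `p` are the square roots of `|I1|` for target and source. The choices give `f1 g^3 = v
0 / u 0` and `f1 g^2 = p / P`, which match `a` and `I1`; `h` is then the shift that matches `b`. -/
theorem push_leading {v u : Fin 5 → ℝ} {P p ε g1 h1 : ℝ} (hε : ε ^ 2 = 1) (hu : u 0 ≠ 0)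
    (hv : v 0 ≠ 0) (hP : 0 < P) (hp : 0 < p) (hP2 : P ^ 2 = ε * (8 * u 0 * u 2 - 3 * u 1 ^ 2))
    (hp2 : p ^ 2 = ε * (8 * v 0 * v 2 - 3 * v 1 ^ 2)) :
    let q := push v (u 0 ^ 2 / P ^ 3 / (v 0 ^ 2 / p ^ 3)) (v 0 * P / (u 0 * p)) g1
      ((v 1 * P / p - u 1) / (4 * u 0)) h1
    q 0 = u 0 ∧ q 1 = u 1 ∧ q 2 = u 2 := by
  intro q
  have h0 : q 0 = u 0 := by
    simp only [q, push_zero]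
    field_simp
  have h1 : q 1 = u 1 := by
    simp only [q] at h0 ⊢
    rw [push_one, h0]
    field_simp
    ring
  refine ⟨h0, h1, ?_⟩
  simp only [q] at h0 h1 ⊢
  rw [push_two, h0, h1]
  -- Since `a ≠ 0`, the coefficient `c` is recovered from `a`, `b` and `I1`, so matching those three
  -- suffices.
  have hu2 : u 2 = (ε * P ^ 2 + 3 * u 1 ^ 2) / (8 * u 0) := by
    rw [eq_div_iff (by positivity), hP2]
    linear_combination (-(8 * u 0 * u 2 - 3 * u 1 ^ 2)) * hε
  have hv2 : v 2 = (ε * p ^ 2 + 3 * v 1 ^ 2) / (8 * v 0) := by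
    rw [eq_div_iff (by positivity), hp2]
    linear_combination (-(8 * v 0 * v 2 - 3 * v 1 ^ 2)) * hε
  rw [hu2, hv2]
  field_simp
  ring

variable {v f1 g g1 h h1}

theorem contDiffOn_push {B : Set ℝ} {s : ℝ → Fin 5 → ℝ} {f1 g g1 h h1 : ℝ → ℝ}
    (hs : ContDiffOn ℝ ∞ s B) (hf1 : ContDiffOn ℝ ∞ f1 B) (hg : ContDiffOn ℝ ∞ g B)
    (hg1 : ContDiffOn ℝ ∞ g1 B) (hh : ContDiffOn ℝ ∞ h B) (hh1 : ContDiffOn ℝ ∞ h1 B)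
    (hf0 : ∀ x ∈ B, f1 x ≠ 0) (hg0 : ∀ x ∈ B, g x ≠ 0) :
    ContDiffOn ℝ ∞ (fun x => push (s x) (f1 x) (g x) (g1 x) (h x) (h1 x)) B := by
  have hc := contDiffOn_pi.1 hs
  have hA : ContDiffOn ℝ ∞ (fun x => push (s x) (f1 x) (g x) (g1 x) (h x) (h1 x) 0) B :=
    (hc 0).div (hf1.mul (hg.pow 3)) fun x hx => mul_ne_zero (hf0 x hx) (pow_ne_zero 3 (hg0 x hx))
  have hB : ContDiffOn ℝ ∞ (fun x => push (s x) (f1 x) (g x) (g1 x) (h x) (h1 x) 1) B :=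
    ((hc 1).div (hf1.mul (hg.pow 2)) fun x hx =>
      mul_ne_zero (hf0 x hx) (pow_ne_zero 2 (hg0 x hx))).sub ((contDiffOn_const.mul hA).mul hh)
  have hC : ContDiffOn ℝ ∞ (fun x => push (s x) (f1 x) (g x) (g1 x) (h x) (h1 x) 2) B :=
    (((hc 2).div (hf1.mul hg) fun x hx => mul_ne_zero (hf0 x hx) (hg0 x hx)).sub
      ((contDiffOn_const.mul hA).mul (hh.pow 2))).sub ((contDiffOn_const.mul hB).mul hh)
  have hD : ContDiffOn ℝ ∞ (fun x => push (s x) (f1 x) (g x) (g1 x) (h x) (h1 x) 3) B :=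
    (((((hc 3).add (hg1.div hg hg0)).div hf1 hf0).sub
      ((contDiffOn_const.mul hA).mul (hh.pow 3))).sub
      ((contDiffOn_const.mul hB).mul (hh.pow 2))).sub ((contDiffOn_const.mul hC).mul hh)
  have hE : ContDiffOn ℝ ∞ (fun x => push (s x) (f1 x) (g x) (g1 x) (h x) (h1 x) 4) B :=
    (((hg.mul (hc 4)).add hh1).div hf1 hf0).sub
      ((((hA.mul (hh.pow 4)).add (hB.mul (hh.pow 3))).add (hC.mul (hh.pow 2))).add (hD.mul hh))
  refine contDiffOn_pi.2 fun α => ?_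
  fin_cases α
  exacts [hA, hB, hC, hD, hE]

/-- Every smooth section is sent to a smooth section by the transformation with the given
components. -/
theorem sameOrbit_push {B : Set ℝ} (hB : IsOpen B) {e : OpenPartialHomeomorph ℝ ℝ}
    (hBe : B ⊆ e.source) (he : ContDiffOn ℝ ∞ e e.source) (hei : ContDiffOn ℝ ∞ e.symm e.target)
    {s : ℝ → Fin 5 → ℝ} {f1 g g1 h h1 : ℝ → ℝ} (hs : ContDiffOn ℝ ∞ s B)
    (hg : ContDiffOn ℝ ∞ g B) (hh : ContDiffOn ℝ ∞ h B) (hf1 : ∀ x ∈ B, HasDerivAt e (f1 x) x)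
    (hg1 : ∀ x ∈ B, HasDerivAt g (g1 x) x) (hh1 : ∀ x ∈ B, HasDerivAt h (h1 x) x)
    (hf0 : ∀ x ∈ B, 0 < f1 x) (hg0 : ∀ x ∈ B, g x ≠ 0) :
    ContDiffOn ℝ ∞ ((fun x => push (s x) (f1 x) (g x) (g1 x) (h x) (h1 x)) ∘ e.symm) (e '' B) ∧
    ∀ k, ∀ x ∈ B, SameOrbit k (jet k s x)
      (jet k ((fun x => push (s x) (f1 x) (g x) (g1 x) (h x) (h1 x)) ∘ e.symm) (e x)) := by
  have hsm : ∀ {u u1 : ℝ → ℝ}, ContDiffOn ℝ ∞ u B → (∀ x ∈ B, HasDerivAt u (u1 x) x) →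
      ContDiffOn ℝ ∞ u1 B := fun hu hd =>
    ((contDiffOn_infty_iff_deriv_of_isOpen hB).1 hu).2.congr fun x hx => (hd x hx).deriv.symm
  have hp := contDiffOn_push hs (hsm (he.mono hBe) hf1) hg (hsm hg hg1) hh (hsm hh hh1)
    (fun x hx => (hf0 x hx).ne') hg0
  have ht : ContDiffOn ℝ ∞ ((fun x => push (s x) (f1 x) (g x) (g1 x) (h x) (h1 x)) ∘ e.symm)
      (e '' B) := by
    refine hp.comp (hei.mono ?_) ?_
    · rintro _ ⟨x, hx, rfl⟩
      exact e.map_source (hBe hx)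
    · rintro _ ⟨x, hx, rfl⟩
      rwa [e.left_inv (hBe hx)]
  refine ⟨ht, fun k x hx => ?_⟩
  let φ : Trans :=
    { dom := B
      f := e
      g := g
      h := h
      isOpen_dom := hB
      smooth_f := he.mono hBe
      smooth_g := hg
      smooth_h := hh
      injOn_f := e.injOn.mono hBe
      deriv_f_pos := fun x hx => by rw [(hf1 x hx).deriv]; exact hf0 x hx
      g_ne_zero := hg0 }
  refine ⟨φ, hx, s, _, hs, ht, fun y hy w => ?_, rfl, rfl⟩
  simp only [φ, Function.comp_apply, e.left_inv (hBe hy), (hf1 y hy).deriv, (hg1 y hy).deriv,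
    (hh1 y hy).deriv]
  exact rhs_push _ _ _ _ _ _ w (hf0 y hy).ne' (hg0 y hy)

end Pushforward

/-! ### Calculus of agreement to order `n`. -/

section Agreement

/-- `u` and `v` are continuous at `x₀` and their difference vanishes there to order `n`. -/
def AgreeTo (x₀ : ℝ) (n : ℕ) (u v : ℝ → ℝ) : Prop :=
  ContinuousAt u x₀ ∧ ContinuousAt v x₀ ∧ (fun x => u x - v x) =O[𝓝 x₀] fun x => (x - x₀) ^ n

namespace AgreeTo

variable {x₀ : ℝ} {n : ℕ} {u v u' v' w : ℝ → ℝ}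

theorem refl (hu : ContinuousAt u x₀) : AgreeTo x₀ n u u :=
  ⟨hu, hu, by simpa using isBigO_zero _ _⟩

theorem congr_right (h : AgreeTo x₀ n u v) (hv : v =ᶠ[𝓝 x₀] w) : AgreeTo x₀ n u w :=
  ⟨h.1, h.2.1.congr hv, h.2.2.congr' (by filter_upwards [hv] with x hx using by rw [hx])
    EventuallyEq.rfl⟩

theorem add (h : AgreeTo x₀ n u v) (h' : AgreeTo x₀ n u' v') :
    AgreeTo x₀ n (fun x => u x + u' x) (fun x => v x + v' x) :=
  ⟨h.1.add h'.1, h.2.1.add h'.2.1, (h.2.2.add h'.2.2).congr_left fun x => by ring⟩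

theorem sub (h : AgreeTo x₀ n u v) (h' : AgreeTo x₀ n u' v') :
    AgreeTo x₀ n (fun x => u x - u' x) (fun x => v x - v' x) :=
  ⟨h.1.sub h'.1, h.2.1.sub h'.2.1, (h.2.2.sub h'.2.2).congr_left fun x => by ring⟩

theorem mul (h : AgreeTo x₀ n u v) (h' : AgreeTo x₀ n u' v') :
    AgreeTo x₀ n (fun x => u x * u' x) (fun x => v x * v' x) := by
  refine ⟨h.1.mul h'.1, h.2.1.mul h'.2.1, ?_⟩
  have h1 := (h.1.isBigO_one ℝ).mul h'.2.2
  have h2 := (h'.2.1.isBigO_one ℝ).mul h.2.2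
  refine ((h1.add h2).congr (fun x => ?_) fun x => one_mul _)
  ring

theorem pow (h : AgreeTo x₀ n u v) (m : ℕ) :
    AgreeTo x₀ n (fun x => u x ^ m) (fun x => v x ^ m) := by
  induction m with
  | zero => simpa using refl continuousAt_const
  | succ m ih => simpa only [pow_succ] using ih.mul h

theorem inv (h : AgreeTo x₀ n u v) (hu : u x₀ ≠ 0) (hv : v x₀ ≠ 0) :
    AgreeTo x₀ n (fun x => (u x)⁻¹) (fun x => (v x)⁻¹) := by
  refine ⟨h.1.inv₀ hu, h.2.1.inv₀ hv, ?_⟩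
  have h1 := (((h.1.inv₀ hu).mul (h.2.1.inv₀ hv)).neg.isBigO_one ℝ).mul h.2.2
  refine h1.congr' ?_ (by simp)
  filter_upwards [h.1.eventually_ne hu, h.2.1.eventually_ne hv] with x hx hx'
  simp only [Pi.neg_apply, Pi.mul_apply, Pi.inv_apply]
  field_simp
  ring

theorem div (h : AgreeTo x₀ n u v) (h' : AgreeTo x₀ n u' v') (hu : u' x₀ ≠ 0) (hv : v' x₀ ≠ 0) :
    AgreeTo x₀ n (fun x => u x / u' x) (fun x => v x / v' x) := by
  simpa only [div_eq_mul_inv] using h.mul (h'.inv hu hv)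

end AgreeTo

theorem isBigO_pow_comp {E : Type*} [NormedAddCommGroup E] {u : ℝ → E} {q : ℝ → ℝ} {x₀ y₀ : ℝ}
    {n : ℕ} (hu : u =O[𝓝 x₀] fun x => (x - x₀) ^ n) (hq : DifferentiableAt ℝ q y₀)
    (h0 : q y₀ = x₀) : (u ∘ q) =O[𝓝 y₀] fun y => (y - y₀) ^ n := by
  subst h0
  exact (hu.comp_tendsto hq.continuousAt).trans (hq.isBigO_sub.pow n)

end Agreement


/-! ### Separation of regular orbits and generation of the invariants. -/

section Orbits

theorem agreeTo_exp {γ : ℝ → ℝ} {x₀ : ℝ} {n : ℕ} (hc : ContinuousAt γ x₀) (h0 : γ x₀ = 0)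
    (hγ : γ =O[𝓝 x₀] fun x => (x - x₀) ^ n) :
    AgreeTo x₀ n (fun x => Real.exp (γ x)) fun _ => 1 := by
  refine ⟨hc.rexp, continuousAt_const, ?_⟩
  have h := (Real.differentiable_exp (γ x₀)).isBigO_sub.comp_tendsto hc
  refine (h.trans (hγ.congr_left fun x => ?_)).congr_left fun x => ?_
  · simp [h0]
  · simp [h0]

/-- The effect on the transformed coefficients of the corrections `g e^γ` and `h + η` to `g` and
`h`, where `γ` and `η` vanish to order `n`. -/
theorem agreeTo_push {x₀ : ℝ} {n : ℕ} {s : ℝ → Fin 5 → ℝ} {f1 g g1 h h1 γ γ1 η η1 : ℝ → ℝ}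
    (hs : ContinuousAt s x₀) (hf1 : ContinuousAt f1 x₀) (hg : ContinuousAt g x₀)
    (hg1 : ContinuousAt g1 x₀) (hh : ContinuousAt h x₀) (hh1 : ContinuousAt h1 x₀)
    (hγ : ContinuousAt γ x₀) (hγ1 : ContinuousAt γ1 x₀) (hη : ContinuousAt η x₀)
    (hη1 : ContinuousAt η1 x₀) (hf0 : f1 x₀ ≠ 0) (hg0 : g x₀ ≠ 0) (hγ0 : γ x₀ = 0)
    (hγO : γ =O[𝓝 x₀] fun x => (x - x₀) ^ n) (hηO : η =O[𝓝 x₀] fun x => (x - x₀) ^ n) :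
    let q := fun x => push (s x) (f1 x) (g x) (g1 x) (h x) (h1 x)
    let p := fun x => push (s x) (f1 x) (g x * Real.exp (γ x))
      ((g1 x + g x * γ1 x) * Real.exp (γ x)) (h x + η x) (h1 x + η1 x)
    AgreeTo x₀ n (fun x => p x 0) (fun x => q x 0) ∧
    AgreeTo x₀ n (fun x => p x 1) (fun x => q x 1) ∧
    AgreeTo x₀ n (fun x => p x 2) (fun x => q x 2) ∧
    AgreeTo x₀ n (fun x => p x 3) (fun x => q x 3 + γ1 x / f1 x) ∧
    AgreeTo x₀ n (fun x => p x 4) (fun x => q x 4 + (η1 x - γ1 x * h x) / f1 x) := by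
  intro q p
  have hc := continuousAt_pi.1 hs
  have cst : ∀ c : ℝ, AgreeTo x₀ n (fun _ => c) fun _ => c := fun c => AgreeTo.refl continuousAt_const
  have F := AgreeTo.refl (n := n) hf1
  have G : AgreeTo x₀ n (fun x => g x * Real.exp (γ x)) g := by
    simpa using (AgreeTo.refl hg).mul (agreeTo_exp hγ hγ0 hγO)
  have H : AgreeTo x₀ n (fun x => h x + η x) h :=
    ⟨hh.add hη, hh, by simpa using hηO⟩
  have hG0 : g x₀ * Real.exp (γ x₀) ≠ 0 := mul_ne_zero hg0 (Real.exp_ne_zero _)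
  have a0 : AgreeTo x₀ n (fun x => p x 0) (fun x => q x 0) :=
    (AgreeTo.refl (hc 0)).div (F.mul (G.pow 3)) (mul_ne_zero hf0 (pow_ne_zero 3 hG0))
      (mul_ne_zero hf0 (pow_ne_zero 3 hg0))
  have a1 : AgreeTo x₀ n (fun x => p x 1) (fun x => q x 1) :=
    ((AgreeTo.refl (hc 1)).div (F.mul (G.pow 2)) (mul_ne_zero hf0 (pow_ne_zero 2 hG0))
      (mul_ne_zero hf0 (pow_ne_zero 2 hg0))).sub (((cst 4).mul a0).mul H)
  have a2 : AgreeTo x₀ n (fun x => p x 2) (fun x => q x 2) :=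
    (((AgreeTo.refl (hc 2)).div (F.mul G) (mul_ne_zero hf0 hG0)
      (mul_ne_zero hf0 hg0)).sub (((cst 6).mul a0).mul (H.pow 2))).sub (((cst 3).mul a1).mul H)
  -- The transform of `d` contains the logarithmic derivative of `g`, which for `g e^γ` gains
  -- exactly `γ'`: one order below `γ` itself, hence visible in the jet.
  have hgl : (fun x => (g1 x + g x * γ1 x) * Real.exp (γ x) / (g x * Real.exp (γ x))) =ᶠ[𝓝 x₀]
      fun x => g1 x / g x + γ1 x := by
    filter_upwards [hg.eventually_ne hg0] with x hx
    have := Real.exp_ne_zero (γ x)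
    field_simp
  have hcl : ContinuousAt (fun x => (g1 x + g x * γ1 x) * Real.exp (γ x) /
      (g x * Real.exp (γ x))) x₀ :=
    (((hg1.add (hg.mul hγ1)).mul hγ.rexp)).div (hg.mul hγ.rexp) hG0
  have a3 : AgreeTo x₀ n (fun x => p x 3) (fun x => q x 3 + γ1 x / f1 x) := by
    refine ((((((AgreeTo.refl (hc 3)).add ((AgreeTo.refl hcl).congr_right hgl)).div F hf0 hf0).sub
      (((cst 4).mul a0).mul (H.pow 3))).sub
      (((cst 3).mul a1).mul (H.pow 2))).sub (((cst 2).mul a2).mul H)).congr_right ?_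
    filter_upwards with x
    simp only [q, push_three]
    ring
  refine ⟨a0, a1, a2, a3, ?_⟩
  refine ((((G.mul (AgreeTo.refl (hc 4))).add (AgreeTo.refl (hh1.add hη1))).div F hf0 hf0).sub
      ((((a0.mul (H.pow 4)).add (a1.mul (H.pow 3))).add (a2.mul (H.pow 2))).add
        (a3.mul H))).congr_right ?_
  filter_upwards with x
  simp only [q, push_four, Pi.add_apply]
  ring

theorem jet_eq_of_isBigO {s t : ℝ → Fin 5 → ℝ} {O : Set ℝ} {x₀ : ℝ} {k : ℕ} (hO : IsOpen O)
    (hx₀ : x₀ ∈ O) (hs : ContDiffOn ℝ ∞ s O) (ht : ContDiffOn ℝ ∞ t O)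
    (h : (s - t) =O[𝓝 x₀] fun x => (x - x₀) ^ (k + 1)) : jet k s x₀ = jet k t x₀ := by
  have hz : ∀ i < k + 1, iteratedDeriv i (s - t) x₀ = 0 :=
    iteratedDeriv_eq_zero_of_isBigO_pow hO hx₀ (hs.sub ht) h
  refine Prod.ext rfl (funext fun i => ?_)
  have := hz i i.isLt
  rw [iteratedDeriv_sub ((hs.contDiffAt (hO.mem_nhds hx₀)).of_le (by exact_mod_cast le_top))
    ((ht.contDiffAt (hO.mem_nhds hx₀)).of_le (by exact_mod_cast le_top)), sub_eq_zero] at this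
  exact this

theorem weight_eq_sqrt {s : ℝ → Fin 5 → ℝ} {x ε : ℝ} (hε : ε ^ 2 = 1)
    (hI : 0 < ε * (8 * s x 0 * s x 2 - 3 * s x 1 ^ 2)) :
    weight s x = s x 0 ^ 2 / Real.sqrt (ε * (8 * s x 0 * s x 2 - 3 * s x 1 ^ 2)) ^ 3 := by
  have h1 : |8 * s x 0 * s x 2 - 3 * s x 1 ^ 2| = ε * (8 * s x 0 * s x 2 - 3 * s x 1 ^ 2) := by
    have : |ε| = 1 := by rwa [← sq_eq_sq₀ (abs_nonneg ε) zero_le_one, sq_abs, one_pow]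
    rw [← abs_of_pos hI, abs_mul, this, one_mul]
  rw [weight, h1, Real.sqrt_eq_rpow, ← Real.rpow_natCast (_ ^ _) 3, ← Real.rpow_mul hI.le]
  norm_num

/-- Regular jets with the same sign of `I₁` and the same basic invariants lie in one orbit. -/
theorem sameOrbit_of_basic_eq {k : ℕ} {z w : Jet k} (hz : z ∈ regular k) (hw : w ∈ regular k)
    {ε : ℝ} (hε : ε ^ 2 = 1) (hεz : 0 < ε * I1 z) (hεw : 0 < ε * I1 w)
    (hb : basic k z = basic k w) : SameOrbit k z w := by
  obtain ⟨s, hs, hsz⟩ : ∃ s : ℝ → Fin 5 → ℝ, ContDiff ℝ ∞ s ∧ jet k s z.1 = z :=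
    ⟨_, contDiff_taylorSection z.1 z.2, jet_taylorSection z⟩
  obtain ⟨t, ht, htw⟩ : ∃ t : ℝ → Fin 5 → ℝ, ContDiff ℝ ∞ t ∧ jet k t w.1 = w :=
    ⟨_, contDiff_taylorSection w.1 w.2, jet_taylorSection w⟩
  generalize z.1 = x₀ at hsz
  generalize w.1 = y₀ at htw
  subst hsz htw
  rw [I1_jet] at hεz hεw
  have hz0 := left_ne_zero_of_mul ((jet_mem_regular k).1 hz)
  have hw0 := left_ne_zero_of_mul ((jet_mem_regular k).1 hw)
  -- Regularity with the sign of `I1` fixed to `ε`, so that `|I1| = ε I1` has a smooth square root.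
  let O : (ℝ → Fin 5 → ℝ) → Set ℝ := fun s =>
    {x | s x 0 ≠ 0} ∩ {x | 0 < ε * (8 * s x 0 * s x 2 - 3 * s x 1 ^ 2)}
  have hO : ∀ {s : ℝ → Fin 5 → ℝ}, ContDiff ℝ ∞ s → IsOpen (O s) := fun {s} hs => by
    have hc := continuous_pi_iff.1 hs.continuous
    exact (isOpen_ne_fun (hc 0) continuous_const).inter (isOpen_lt continuous_const
      (continuous_const.mul (((continuous_const.mul (hc 0)).mul (hc 2)).sub
        (continuous_const.mul ((hc 1).pow 2)))))
  have hOr : ∀ {s : ℝ → Fin 5 → ℝ}, ∀ x ∈ O s, RegularAt s x := fun {s} x hx =>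
    mul_ne_zero hx.1 (right_ne_zero_of_mul hx.2.ne')
  obtain ⟨e, hx₀, heO, heP, hey, he, hei, hed⟩ := exists_diffeo_of_ode (hO hs) (hO ht)
    (x₀ := x₀) (y₀ := y₀) ⟨hz0, hεz⟩ ⟨hw0, hεw⟩ (contDiffOn_weight hs.contDiffOn hOr)
    (contDiffOn_weight ht.contDiffOn hOr) (fun x hx => (hOr x hx).weight_pos)
    (fun x hx => (hOr x hx).weight_pos)
  subst hey
  obtain ⟨r, hr, hre⟩ := Metric.isOpen_iff.1 e.open_source x₀ hx₀
  set B := Metric.ball x₀ r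
  have hB : IsOpen B := Metric.isOpen_ball
  have hxB : x₀ ∈ B := Metric.mem_ball_self hr
  have hBn : B ∈ 𝓝 x₀ := hB.mem_nhds hxB
  have hBs : ∀ x ∈ B, x ∈ O s := fun x hx => heO (hre hx)
  have hBt : ∀ x ∈ B, e x ∈ O t := fun x hx => heP (e.map_source (hre hx))
  have hsB : ContDiffOn ℝ ∞ s B := hs.contDiffOn
  have hteB : ContDiffOn ℝ ∞ (fun x => t (e x)) B := ht.comp_contDiffOn (he.mono hre)
  have hsc := contDiffOn_pi.1 hsB
  have htc := contDiffOn_pi.1 hteB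
  -- the transformation matching the coefficients `a`, `b`, `c`
  let P : ℝ → ℝ := fun x => Real.sqrt (ε * (8 * t (e x) 0 * t (e x) 2 - 3 * t (e x) 1 ^ 2))
  let p : ℝ → ℝ := fun x => Real.sqrt (ε * (8 * s x 0 * s x 2 - 3 * s x 1 ^ 2))
  have hP0 : ∀ x ∈ B, 0 < P x := fun x hx => Real.sqrt_pos.2 (hBt x hx).2
  have hp0 : ∀ x ∈ B, 0 < p x := fun x hx => Real.sqrt_pos.2 (hBs x hx).2
  have hPc : ContDiffOn ℝ ∞ P B := (contDiffOn_const.mul (((contDiffOn_const.mul (htc 0)).mul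
    (htc 2)).sub (contDiffOn_const.mul ((htc 1).pow 2)))).sqrt fun x hx => (hBt x hx).2.ne'
  have hpc : ContDiffOn ℝ ∞ p B := (contDiffOn_const.mul (((contDiffOn_const.mul (hsc 0)).mul
    (hsc 2)).sub (contDiffOn_const.mul ((hsc 1).pow 2)))).sqrt fun x hx => (hBs x hx).2.ne'
  let f1 : ℝ → ℝ := fun x => t (e x) 0 ^ 2 / P x ^ 3 / (s x 0 ^ 2 / p x ^ 3)
  let g : ℝ → ℝ := fun x => s x 0 * P x / (t (e x) 0 * p x)
  let h : ℝ → ℝ := fun x => (s x 1 * P x / p x - t (e x) 1) / (4 * t (e x) 0)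
  have hg : ContDiffOn ℝ ∞ g B := ((hsc 0).mul hPc).div ((htc 0).mul hpc) fun x hx =>
    mul_ne_zero (hBt x hx).1 (hp0 x hx).ne'
  have hh : ContDiffOn ℝ ∞ h B := ((((hsc 1).mul hPc).div hpc fun x hx => (hp0 x hx).ne').sub
    (htc 1)).div (contDiffOn_const.mul (htc 0)) fun x hx => mul_ne_zero four_ne_zero (hBt x hx).1
  have hf1 : ∀ x ∈ B, HasDerivAt e (f1 x) x := fun x hx => by
    have := hed x (hre hx)
    rwa [weight_eq_sqrt hε (hBt x hx).2, weight_eq_sqrt hε (hBs x hx).2] at this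
  have hf0 : ∀ x ∈ B, 0 < f1 x := fun x hx => by
    have h1 := (hBt x hx).1
    have h2 := (hBs x hx).1
    have h3 := hP0 x hx
    have h4 := hp0 x hx
    simp only [mem_ofPred_eq] at h1 h2
    positivity
  have hg0 : ∀ x ∈ B, g x ≠ 0 := fun x hx =>
    div_ne_zero (mul_ne_zero (hBs x hx).1 (hP0 x hx).ne')
      (mul_ne_zero (hBt x hx).1 (hp0 x hx).ne')
  have hsm : ∀ {u : ℝ → ℝ}, ContDiffOn ℝ ∞ u B → ContDiffOn ℝ ∞ (deriv u) B := fun hu =>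
    ((contDiffOn_infty_iff_deriv_of_isOpen hB).1 hu).2
  have hf1c : ContDiffOn ℝ ∞ f1 B :=
    (hsm (he.mono hre)).congr fun x hx => (hf1 x hx).deriv.symm
  obtain ⟨ht₀, horb₀⟩ := sameOrbit_push hB hre he hei hsB hg hh hf1
    (fun x hx => hg.hasDerivAt_deriv hB hx) (fun x hx => hh.hasDerivAt_deriv hB hx) hf0 hg0
  have hqc := contDiffOn_push hsB hf1c hg (hsm hg) hh (hsm hh) (fun x hx => (hf0 x hx).ne') hg0
  set q : ℝ → Fin 5 → ℝ := fun x => push (s x) (f1 x) (g x) (deriv g x) (h x) (deriv h x) with hq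
  have hqcc := contDiffOn_pi.1 hqc
  have hlead : ∀ x ∈ B, q x 0 = t (e x) 0 ∧ q x 1 = t (e x) 1 ∧ q x 2 = t (e x) 2 := fun x hx =>
    push_leading hε (hBt x hx).1 (hBs x hx).1 (hP0 x hx) (hp0 x hx)
      (Real.sq_sqrt (hBt x hx).2.le) (Real.sq_sqrt (hBs x hx).2.le)
  have hBo : IsOpen (e '' B) := e.isOpen_image_of_subset_source hB hre
  have hSL : SameLeading (q ∘ e.symm) t (e '' B) := by
    rintro _ ⟨x, hx, rfl⟩
    simpa only [Function.comp_apply, e.left_inv (hre hx)] using hlead x hx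
  have htr : ∀ y ∈ e '' B, RegularAt t y := by
    rintro _ ⟨x, hx, rfl⟩
    exact hOr _ (hBt x hx)
  have heB : e x₀ ∈ e '' B := mem_image_of_mem _ hxB
  -- The transformed section stays in the orbit of the first jet, so it carries that jet's
  -- invariants, which by `hb` are those of `t`.
  have hsub := hSL.isBigO_sub hBo ht₀ ht.contDiffOn htr heB
    (((horb₀ k x₀ hxB).basic_eq hz ((jet_mem_regular k).2
      ((hSL.regularAt_iff heB).2 (htr _ heB)))).symm.trans hb)
  have hqt : (fun x => q x - t (e x)) =O[𝓝 x₀] fun x => (x - x₀) ^ k := by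
    refine (isBigO_pow_comp hsub (hf1 x₀ hxB).differentiableAt rfl).congr' ?_ EventuallyEq.rfl
    filter_upwards [hBn] with x hx
    simp [e.left_inv (hre hx)]
  -- the correction matching the derivatives of `d`, `e` of top order
  let γ1 : ℝ → ℝ := fun x => f1 x * (t (e x) 3 - q x 3)
  -- `γ1` and `η1` solve `q 3 + γ1 / f1 = t 3` and `q 4 + (η1 - γ1 h) / f1 = t 4`, the shifts found
  -- in `agreeTo_push`.
  let η1 : ℝ → ℝ := fun x => γ1 x * h x + f1 x * (t (e x) 4 - q x 4)
  have hγ1c : ContDiffOn ℝ ∞ γ1 B := hf1c.mul ((htc 3).sub (hqcc 3))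
  have hη1c : ContDiffOn ℝ ∞ η1 B := (hγ1c.mul hh).add (hf1c.mul ((htc 4).sub (hqcc 4)))
  obtain ⟨γ, hγ0, hγc, hγ⟩ := exists_primitive hr hγ1c
  obtain ⟨η, hη0, hηc, hη⟩ := exists_primitive hr hη1c
  have hcB : ∀ {E : Type} [NormedAddCommGroup E] [NormedSpace ℝ E] {u : ℝ → E},
      ContDiffOn ℝ ∞ u B → ContinuousAt u x₀ := fun hu => hu.continuousOn.continuousAt hBn
  have hqtα : ∀ α, (fun x => t (e x) α - q x α) =O[𝓝 x₀] fun x => (x - x₀) ^ k := fun α =>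
    ((isBigO_pi.1 hqt α).neg_left).congr_left fun x => by simp
  have hγ1O : γ1 =O[𝓝 x₀] fun x => (x - x₀) ^ k :=
    (((hcB hf1c).isBigO_one ℝ).mul (hqtα 3)).congr_right fun x => one_mul _
  have hη1O : η1 =O[𝓝 x₀] fun x => (x - x₀) ^ k :=
    ((hγ1O.mul ((hcB hh).isBigO_one ℝ)).congr_right fun x => mul_one _).add
      ((((hcB hf1c).isBigO_one ℝ).mul (hqtα 4)).congr_right fun x => one_mul _)
  -- `γ1` and `η1` vanish to order `k`; integration gains the one order needed to keep the `k`-jets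
  -- of `a`, `b`, `c` undisturbed.
  have hγO := isBigO_pow_succ_of_hasDerivAt (eventually_of_mem hBn hγ) hγ0 hγ1O
  have hηO := isBigO_pow_succ_of_hasDerivAt (eventually_of_mem hBn hη) hη0 hη1O
  obtain ⟨ht₁, horb₁⟩ := sameOrbit_push hB hre he hei hsB (g := fun x => g x * Real.exp (γ x))
    (h := fun x => h x + η x) (hg.mul hγc.exp) (hh.add hηc) hf1
    (g1 := fun x => (deriv g x + g x * γ1 x) * Real.exp (γ x)) (h1 := fun x => deriv h x + η1 x)
    (fun x hx => ((hg.hasDerivAt_deriv hB hx).mul (hγ x hx).exp).congr_deriv (by ring))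
    (fun x hx => (hh.hasDerivAt_deriv hB hx).add (hη x hx)) hf0
    (fun x hx => mul_ne_zero (hg0 x hx) (Real.exp_ne_zero _))
  obtain ⟨a0, a1, a2, a3, a4⟩ := agreeTo_push (hcB hsB) (hcB hf1c) (hcB hg) (hcB (hsm hg)) (hcB hh)
    (hcB (hsm hh)) (hcB hγc) (hcB hγ1c) (hcB hηc) (hcB hη1c) (hf0 x₀ hxB).ne' (hg0 x₀ hxB) hγ0
    hγO hηO
  have horb := horb₁ k x₀ hxB
  set p' : ℝ → Fin 5 → ℝ := fun x => push (s x) (f1 x) (g x * Real.exp (γ x))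
    ((deriv g x + g x * γ1 x) * Real.exp (γ x)) (h x + η x) (deriv h x + η1 x)
  have hpt : (fun x => p' x - t (e x)) =O[𝓝 x₀] fun x => (x - x₀) ^ (k + 1) := by
    refine isBigO_pi.2 fun α => ?_
    have key : ∀ {α : Fin 5} {v : ℝ → ℝ}, AgreeTo x₀ (k + 1) (fun x => p' x α) v →
        (∀ x ∈ B, v x = t (e x) α) →
        (fun x => (p' x - t (e x)) α) =O[𝓝 x₀] fun x => (x - x₀) ^ (k + 1) := fun ha hv =>
      (ha.congr_right (eventually_of_mem hBn hv)).2.2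
    fin_cases α
    · exact key a0 fun x hx => (hlead x hx).1
    · exact key a1 fun x hx => (hlead x hx).2.1
    · exact key a2 fun x hx => (hlead x hx).2.2
    · refine key (α := 3) a3 fun x hx => ?_
      have := (hf0 x hx).ne'
      simp only [γ1, hq]
      field_simp
      ring
    · refine key (α := 4) a4 fun x hx => ?_
      have := (hf0 x hx).ne'
      simp only [η1, hq]
      field_simp
      ring
  have hfin : (p' ∘ e.symm - t) =O[𝓝 (e x₀)] fun y => (y - e x₀) ^ (k + 1) := by
    refine (isBigO_pow_comp (q := e.symm) hpt ((hei.contDiffAt (e.open_target.mem_nhds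
      (e.map_source hx₀))).differentiableAt (by simp)) (e.left_inv hx₀)).congr' ?_ EventuallyEq.rfl
    filter_upwards [e.open_target.mem_nhds (e.map_source hx₀)] with y hy
    simp [e.right_inv hy]
  rw [jet_eq_of_isBigO hBo heB ht₁ ht.contDiffOn hfin] at horb
  exact horb

theorem sameOrbit_iff {k : ℕ} {z w : Jet k} (hz : z ∈ regular k) (hw : w ∈ regular k) :
    SameOrbit k z w ↔
      SignType.sign (I1 z) = SignType.sign (I1 w) ∧ basic k z = basic k w := by
  refine ⟨fun h => ⟨h.sign_I1_eq, h.basic_eq hz hw⟩, fun ⟨h, hb⟩ => ?_⟩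
  rcases lt_or_gt_of_ne (I1_ne_zero hz) with hlt | hgt
  · have hw' : I1 w < 0 := sign_eq_neg_one_iff.1 (h.symm.trans (sign_neg hlt))
    exact sameOrbit_of_basic_eq (ε := -1) hz hw (by norm_num) (by linarith) (by linarith) hb
  · have hw' : 0 < I1 w := sign_eq_one_iff.1 (h.symm.trans (sign_pos hgt))
    exact sameOrbit_of_basic_eq (ε := 1) hz hw (by norm_num) (by linarith) (by linarith) hb

/-- On regular points the sign is locally constant, hence smooth. It supplies the discrete part of
the separation criterion. -/
theorem isDiffInvariant_sign_I1 (k : ℕ) :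
    IsDiffInvariant k (regular k) fun z => (SignType.sign (I1 z) : ℝ) := by
  refine ⟨fun z hz => ?_, fun z _ w _ h => by simp only [h.sign_I1_eq]⟩
  refine ContDiffAt.contDiffWithinAt ?_
  have hc := (contDiff_I1 (k := k)).continuous.continuousAt (x := z)
  refine (contDiffAt_const (c := (SignType.sign (I1 z) : ℝ))).congr_of_eventuallyEq ?_
  rcases lt_or_gt_of_ne (I1_ne_zero hz) with hlt | hgt
  · filter_upwards [hc.eventually_lt_const hlt] with y hy
    rw [sign_neg hy, sign_neg hlt]
  · filter_upwards [hc.eventually_const_lt hgt] with y hy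
    rw [sign_pos hy, sign_pos hgt]

/-- An invariant on an open set of regular jets with `I₁` of constant sign is a smooth function of
the basic invariants. -/
theorem IsDiffInvariant.isGeneratedOn {k : ℕ} {W : Set (Jet k)} {I : Jet k → ℝ} (hW : IsOpen W)
    (hWr : W ⊆ regular k) (hI : IsDiffInvariant k W I)
    (hsign : ∀ z ∈ W, ∀ w ∈ W, SignType.sign (I1 z) = SignType.sign (I1 w)) :
    IsGeneratedOn k W I := by
  classical
  have hloc : ∀ z ∈ W, ∃ q : (Fin 2 → Fin k → ℝ) → Jet k, ContDiff ℝ ∞ q ∧ q (basic k z) = z ∧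
      ∀ᶠ v in 𝓝 (basic k z), q v ∈ W ∧ basic k (q v) = v := fun z hz => by
    obtain ⟨q, hq, hqz, hqb⟩ := exists_local_section_basic (hWr hz)
    refine ⟨q, hq, hqz, ?_⟩
    filter_upwards [hq.continuous.continuousAt.eventually_mem (by
      rw [hqz]; exact hW.mem_nhds hz)] with v hv using ⟨hv, hqb v⟩
  -- The choice of preimage is immaterial: with the sign of `I1` constant on `W`, points with equal
  -- invariants lie in one orbit. The value `0` is only taken off the open image of `W`.
  let F : (Fin 2 → Fin k → ℝ) → ℝ := fun v =>
    if h : ∃ z ∈ W, basic k z = v then I h.choose else 0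
  have hF : ∀ z ∈ W, F (basic k z) = I z := fun z hz => by
    have h : ∃ z' ∈ W, basic k z' = basic k z := ⟨z, hz, rfl⟩
    obtain ⟨h1, h2⟩ := h.choose_spec
    simp only [F, dif_pos h]
    exact hI.2 _ h1 _ hz ((sameOrbit_iff (hWr h1) (hWr hz)).2 ⟨hsign _ h1 _ hz, h2⟩)
  refine ⟨basic k '' W, F, isOpen_iff_mem_nhds.2 ?_, ?_, fun z hz =>
    ⟨mem_image_of_mem _ hz, (hF z hz).symm⟩⟩
  · rintro _ ⟨z, hz, rfl⟩
    obtain ⟨q, -, -, hq⟩ := hloc z hz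
    filter_upwards [hq] with v hv using ⟨q v, hv.1, hv.2⟩
  · rintro _ ⟨z, hz, rfl⟩
    obtain ⟨q, hqc, hqz, hq⟩ := hloc z hz
    refine ContDiffAt.contDiffWithinAt ?_
    have h1 : ContDiffAt ℝ ∞ I (q (basic k z)) := by
      rw [hqz]
      exact hI.1.contDiffAt (hW.mem_nhds hz)
    -- Near `basic k z` the descended function is `I ∘ q`, a composite of smooth maps.
    refine (h1.comp _ hqc.contDiffAt).congr_of_eventuallyEq ?_
    filter_upwards [hq] with v hv
    rw [Function.comp_apply, ← hF _ hv.1, hv.2]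

theorem IsDiffInvariant.mono {k : ℕ} {U W : Set (Jet k)} {I : Jet k → ℝ}
    (hI : IsDiffInvariant k U I) (h : W ⊆ U) : IsDiffInvariant k W I :=
  ⟨hI.1.mono h, fun z hz w hw => hI.2 z (h hz) w (h hw)⟩

theorem IsGeneratedOn.contDiffOn {k : ℕ} {W : Set (Jet k)} {I : Jet k → ℝ}
    (hWr : W ⊆ regular k) (hI : IsGeneratedOn k W I) : ContDiffOn ℝ ∞ I W := by
  obtain ⟨V, F, -, hF, h⟩ := hI
  exact (hF.comp ((contDiffOn_basic k).mono hWr) fun z hz => (h z hz).1).congr fun z hz => (h z hz).2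

/-- The two parts may carry unrelated functions of the generators because an orbit never meets both:
the sign of `I1` is preserved. -/
theorem isDiffInvariant_iff_isGeneratedOn {k : ℕ} {U : Set (Jet k)} {I : Jet k → ℝ}
    (hU : IsOpen U) (hUr : U ⊆ regular k) :
    IsDiffInvariant k U I ↔
      IsGeneratedOn k (U ∩ {z | 0 < I1 z}) I ∧ IsGeneratedOn k (U ∩ {z | I1 z < 0}) I := by
  have hc := (contDiff_I1 (k := k)).continuous
  have hpos : IsOpen (U ∩ {z | 0 < I1 z}) := hU.inter (isOpen_lt continuous_const hc)
  have hneg : IsOpen (U ∩ {z | I1 z < 0}) := hU.inter (isOpen_lt hc continuous_const)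
  constructor
  · intro hI
    exact ⟨(hI.mono inter_subset_left).isGeneratedOn hpos (inter_subset_left.trans hUr)
        fun z hz w hw => (sign_pos hz.2).trans (sign_pos hw.2).symm,
      (hI.mono inter_subset_left).isGeneratedOn hneg (inter_subset_left.trans hUr)
        fun z hz w hw => (sign_neg hz.2).trans (sign_neg hw.2).symm⟩
  · rintro ⟨hp, hn⟩
    refine ⟨fun z hz => ?_, fun z hz w hw h => ?_⟩
    · rcases lt_or_gt_of_ne (I1_ne_zero (hUr hz)) with hlt | hgt
      · exact ((hn.contDiffOn (inter_subset_left.trans hUr)).contDiffAt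
          (hneg.mem_nhds ⟨hz, hlt⟩)).contDiffWithinAt
      · exact ((hp.contDiffOn (inter_subset_left.trans hUr)).contDiffAt
          (hpos.mem_nhds ⟨hz, hgt⟩)).contDiffWithinAt
    · have hs := h.sign_I1_eq
      have hb := h.basic_eq (hUr hz) (hUr hw)
      rcases lt_or_gt_of_ne (I1_ne_zero (hUr hz)) with hlt | hgt
      · have hw' : I1 w < 0 := sign_eq_neg_one_iff.1 (hs.symm.trans (sign_neg hlt))
        obtain ⟨V, F, -, -, hF⟩ := hn
        rw [(hF z ⟨hz, hlt⟩).2, (hF w ⟨hw, hw'⟩).2, hb]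
      · have hw' : 0 < I1 w := sign_eq_one_iff.1 (hs.symm.trans (sign_pos hgt))
        obtain ⟨V, F, -, -, hF⟩ := hp
        rw [(hF z ⟨hz, hgt⟩).2, (hF w ⟨hw, hw'⟩).2, hb]

theorem sameOrbit_of_forall_isDiffInvariant {k : ℕ} {z w : Jet k} (hz : z ∈ regular k)
    (hw : w ∈ regular k)
    (h : ∀ I : Jet k → ℝ, IsDiffInvariant k (regular k) I → I z = I w) : SameOrbit k z w := by
  refine (sameOrbit_iff hz hw).2 ⟨?_, ?_⟩
  · have h1 := h _ (isDiffInvariant_sign_I1 k)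
    rcases lt_or_gt_of_ne (I1_ne_zero hz) with hz' | hz' <;>
      rcases lt_or_gt_of_ne (I1_ne_zero hw) with hw' | hw' <;>
      simp only [sign_neg, sign_pos, hz', hw'] at h1 ⊢ <;> norm_num at h1
  · funext j i
    exact h _ (isDiffInvariant_basic j i)

end Orbits

end GenAbel

theorem theorem4 :
    -- `J_1`, `J_2` are first-order differential invariants on the regular points
    (GenAbel.IsDiffInvariant 1 (GenAbel.regular 1) GenAbel.J1 ∧
      GenAbel.IsDiffInvariant 1 (GenAbel.regular 1) GenAbel.J2) ∧
    -- `∇` is an invariant derivation; it sends differential invariants to differential invariants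
    GenAbel.NablaInvariant ∧
    (∀ (k : ℕ) (U : Set (GenAbel.Jet k)) (I : GenAbel.Jet k → ℝ),
      IsOpen U → U ⊆ GenAbel.regular k → GenAbel.IsDiffInvariant k U I →
        GenAbel.IsDiffInvariant (k + 1) (GenAbel.proj (Nat.le_succ k) ⁻¹' U)
          (GenAbel.nabla I)) ∧
    -- generation: on each of the parts `I_1 > 0`, `I_1 < 0`, the differential invariants of
    -- order `≤ k` are exactly the smooth functions of the `∇^i J_1`, `∇^i J_2` with `i < k`
    (∀ (k : ℕ) (U : Set (GenAbel.Jet k)) (I : GenAbel.Jet k → ℝ),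
      IsOpen U → U ⊆ GenAbel.regular k →
        (GenAbel.IsDiffInvariant k U I ↔
          GenAbel.IsGeneratedOn k (U ∩ {z | 0 < GenAbel.I1 z}) I ∧
          GenAbel.IsGeneratedOn k (U ∩ {z | GenAbel.I1 z < 0}) I)) ∧
    -- separation: regular points at which all differential invariants agree lie in one orbit
    (∀ (k : ℕ), ∀ z ∈ GenAbel.regular k, ∀ w ∈ GenAbel.regular k,
      (∀ I : GenAbel.Jet k → ℝ, GenAbel.IsDiffInvariant k (GenAbel.regular k) I → I z = I w) →
        GenAbel.SameOrbit k z w) ∧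
    -- more precisely, the sign of `I_1` and the generators separate the regular orbits
    (∀ (k : ℕ), ∀ z ∈ GenAbel.regular k, ∀ w ∈ GenAbel.regular k,
      (GenAbel.SameOrbit k z w ↔
        SignType.sign (GenAbel.I1 z) = SignType.sign (GenAbel.I1 w) ∧
          GenAbel.basic k z = GenAbel.basic k w)) := by
  exact ⟨⟨GenAbel.isDiffInvariant_J1, GenAbel.isDiffInvariant_J2⟩, GenAbel.nablaInvariant,
    fun _ _ _ hU hUr hI => hI.nabla hU hUr,
    fun _ _ _ hU hUr => GenAbel.isDiffInvariant_iff_isGeneratedOn hU hUr,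
    fun _ _ hz _ hw h => GenAbel.sameOrbit_of_forall_isDiffInvariant hz hw h,
    fun _ _ hz _ hw => GenAbel.sameOrbit_iff hz hw⟩
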